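/- Notation. Let $n\ge 2$ and let $\mathcal T$ be a vector addition system of dimension $n$, i.e. a finite set of vectors ("transitions") in $\mathbb Z^n$. Write $\|\mathcal T\|=\max\{|b(i)| : b\in\mathcal T,\ 1\le i\le n\}$ and $\mathrm{pic}(\mathcal T)=\max\{\max(0,-b(i)) : b\in\mathcal T,\ 1\le i\le n\}$, and assume $\mathrm{pic}(\mathcal T)\ge 1$. A pseudo-run is a sequence $u_0,\dots,u_k$ ($k\ge 0$) in $\mathbb Z^n$ with $u_m=u_{m-1}+t_m$, $t_m\in\mathcal T$, for $1\le m\le k$; its length is $k+1$. An interval is an expression $]-\infty,+\infty[$, $[a,+\infty[$, $]-\infty,b]$ or $[a,b]$ with $a,b\in\mathbb Z$. A generalized unboundedness property $\mathcal P=(\mathcal I_1,\dots,\mathcal I_K)$ is a sequence of length $K\ge 1$ of $n$-tuples of intervals; its scale $\|\mathcal P\|$ is the maximum of $1$ and of the absolute values of the integers occurring in its interval expressions. For $1\le l\le K$ and $\mathrm{INCR},I\subseteq\{1,\dots,n\}$, a pseudo-run satisfies $\mathcal A[\mathcal P,l,\mathrm{INCR},I,+\infty]$ if there are positions $0=f(2l-2)\le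 f(2l-1)\le\dots\le f(2K)=k$ such that, with $y_i=u_{f(i)}$ and $d_{l'}(j)=y_{2l'}(j)-y_{2l'-1}(j)$: 1. $d_{l'}(j)\in\mathcal I_{l'}(j)$ for all $l\le l'\le K$ and $1\le j\le n$; 2. for all $l\le l'\le K$ and $1\le j\le n$, if $d_{l'}(j)<0$ then $j\in\mathrm{INCR}$ or $d_{l''}(j)>0$ for some $l\le l''<l'$; 3. for all $l-1\le l'\le K$, all positions $m$ with $f(2l')\le m<f(2l'+2)$ (for $l'=K$: $m=k$), and all $j\in I\setminus(\mathrm{INCR}\cup\{j : d_{l''}(j)>0 \text{ for some } l\le l''\le l'\})$, we have $u_m(j)\ge 0$. For a natural number $C_1$ put $\mu=(1+K)\cdot\|\mathcal T\|\cdot\|\mathcal P\|$ and $$g(0)=(2\mu)^{n^{C_1}},\qquad g(i)=\bigl(2\mu\,(\mathrm{pic}(\mathcal T)\, g(i-1))\bigr)^{n^{C_1}}+g(i-1)\quad(i>0).$$ Statement. There is a constant $C_1\in\mathbb N$ (independent of $n$, $\mathcal T$, $\mathcal P$, $K$, $l$, $\mathrm{INCR}$, $I$ and of the pseudo-run) such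 that for all $n$, $\mathcal T$, $\mathcal P$, $l$, $\mathrm{INCR}$, $I$ as above: if a pseudo-run $\rho$ of $\mathcal T$ satisfies $\mathcal A[\mathcal P,l,\mathrm{INCR},I,+\infty]$, then there is a pseudo-run $\rho'$ of $\mathcal T$ that starts from the same pseudo-configuration as $\rho$, satisfies $\mathcal A[\mathcal P,l,\mathrm{INCR},I,+\infty]$ and has length at most $g(|I|)$. -/

import Mathlib

namespace VAS

/-- Expressions for intervals of integers:
`]-∞,+∞[`, `[a,+∞[`, `]-∞,b]` and `[a,b]`, with `a b : ℤ`. -/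
inductive IntervalExpr where
  | univ : IntervalExpr
  | ici (a : ℤ) : IntervalExpr
  | iic (b : ℤ) : IntervalExpr
  | icc (a b : ℤ) : IntervalExpr

/-- The set of integers denoted by an interval expression. -/
def IntervalExpr.toSet : IntervalExpr → Set ℤ
  | .univ => Set.univ
  | .ici a => Set.Ici a
  | .iic b => Set.Iic b
  | .icc a b => Set.Icc a b

/-- The maximal absolute value of the integers occurring in an interval expression
(`0` if there are none). -/
def IntervalExpr.maxAbs : IntervalExpr → ℕ
  | .univ => 0
  | .ici a => a.natAbs
  | .iic b => b.natAbs
  | .icc a b => max a.natAbs b.natAbs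

/-- A generalized unboundedness property `(𝓘₁, …, 𝓘_K)` in dimension `n`: a nonempty sequence of
`n`-tuples of intervals. `P.K` is its length, and `P.interval ⟨l, _⟩` is the tuple `𝓘_l`. -/
structure GenUnbProp (n : ℕ) where
  /-- the length of the property -/
  K : ℕ
  one_le_K : 1 ≤ K
  /-- the tuples of intervals, indexed by `1, …, K` -/
  interval : Finset.Icc 1 K → Fin n → IntervalExpr

/-- The scale of a generalized unboundedness property: the maximum of `1` and of the absolute
values of the integers occurring in its interval expressions. -/
def GenUnbProp.scale {n : ℕ} (P : GenUnbProp n) : ℕ :=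
  max 1 (Finset.univ.sup fun l : Finset.Icc 1 P.K =>
    Finset.univ.sup fun j : Fin n => (P.interval l j).maxAbs)

/-- The maximal absolute value of an entry of a transition of the VAS `T`. -/
def absMax {n : ℕ} (T : Finset (Fin n → ℤ)) : ℕ :=
  T.sup fun b => Finset.univ.sup fun i : Fin n => (b i).natAbs

/-- The maximum over the transitions `b` of the VAS `T` and the components `i` of
`max 0 (-b i)`. -/
def maxDec {n : ℕ} (T : Finset (Fin n → ℤ)) : ℕ :=
  T.sup fun b => Finset.univ.sup fun i : Fin n => (-(b i)).toNat

/-- A pseudo-run of the VAS `T` (a finite set of vectors in `ℤⁿ`): it is induced by a path, i.e.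
a finite sequence of transitions, from an initial pseudo-configuration in `ℤⁿ`. -/
structure PseudoRun {n : ℕ} (T : Finset (Fin n → ℤ)) where
  /-- the initial pseudo-configuration -/
  initial : Fin n → ℤ
  /-- the inducing path -/
  path : List (Fin n → ℤ)
  path_mem : ∀ t ∈ path, t ∈ T

namespace PseudoRun

variable {n : ℕ} {T : Finset (Fin n → ℤ)}

/-- The pseudo-configurations `u₀, …, u_k` of a pseudo-run whose path has `k` transitions. -/
def config (ρ : PseudoRun T) (m : ℕ) : Fin n → ℤ :=
  ρ.initial + (ρ.path.take m).sum

/-- The length of a pseudo-run is its number of pseudo-configurations. -/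
def length (ρ : PseudoRun T) : ℕ := ρ.path.length + 1

/-- `f` presents the pseudo-run in the form
`y_{2l-2} ⟶ y_{2l-1} ⟶ y_{2l} ⟶ ⋯ ⟶ y_{2K-1} ⟶ y_{2K}`,
where `f i` is the position of `y_i` along the pseudo-run. -/
def IsDecomposition (ρ : PseudoRun T) (l K : ℕ) (f : ℕ → ℕ) : Prop :=
  f (2 * l - 2) = 0 ∧ f (2 * K) = ρ.path.length ∧ MonotoneOn f (Set.Icc (2 * l - 2) (2 * K))

/-- The difference `y_{2l'}(j) - y_{2l'-1}(j)`, for `y_i` at position `f i`. -/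
def diff (ρ : PseudoRun T) (f : ℕ → ℕ) (l' : ℕ) (j : Fin n) : ℤ :=
  ρ.config (f (2 * l')) j - ρ.config (f (2 * l' - 1)) j

/-- The pseudo-run satisfies the approximation property `𝓐[P, l, INCR, I, B]`; `B = ⊤` is the
case `B = +∞`. It is required to admit a decomposition such that:
* for `l' ∈ [l, K]`, the difference of `y_{2l'}` and `y_{2l'-1}` lies in the intervals of `𝓘_{l'}`;
* a component may decrease from `y_{2l'-1}` to `y_{2l'}` only if it is in `INCR` or
  increases from `y_{2l''-1}` to `y_{2l''}` for some `l ≤ l'' < l'`;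
* for `l' ∈ [l-1, K]`, at the positions from that of `y_{2l'}` and strictly before that of
  `y_{2l'+2}` (for `l' = K`: at the last position), every component of `I` that is neither in
  `INCR` nor increased from `y_{2l''-1}` to `y_{2l''}` for some `l ≤ l'' ≤ l'`
  has a value in `[0, B-1]` (in `ℕ` when `B = +∞`). -/
def SatisfiesApprox (ρ : PseudoRun T) (P : GenUnbProp n) (l : ℕ) (INCR I : Finset (Fin n))
    (B : ℕ∞) : Prop :=
  ∃ f : ℕ → ℕ, ρ.IsDecomposition l P.K f ∧
    (∀ (l' : ℕ) (h : l' ∈ Finset.Icc 1 P.K), l ≤ l' → ∀ j : Fin n,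
      ρ.diff f l' j ∈ (P.interval ⟨l', h⟩ j).toSet) ∧
    (∀ l' : ℕ, l ≤ l' → l' ≤ P.K → ∀ j : Fin n, ρ.diff f l' j < 0 →
      (∃ l'' : ℕ, l ≤ l'' ∧ l'' < l' ∧ 0 < ρ.diff f l'' j) ∨ j ∈ INCR) ∧
    (∀ l' : ℕ, l - 1 ≤ l' → l' ≤ P.K → ∀ m : ℕ, m ≤ ρ.path.length →
      f (2 * l') ≤ m → (l' < P.K → m < f (2 * l' + 2)) →
      ∀ j ∈ I, j ∉ INCR → (¬ ∃ l'' : ℕ, l ≤ l'' ∧ l'' ≤ l' ∧ 0 < ρ.diff f l'' j) →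
        0 ≤ ρ.config m j ∧ ((ρ.config m j).toNat : ℕ∞) < B)

end PseudoRun

/-- The quantity `μ = (1 + K) × absMax T × scale P`. -/
def mu {n : ℕ} (T : Finset (Fin n → ℤ)) (P : GenUnbProp n) : ℕ :=
  (1 + P.K) * absMax T * P.scale

/-- The bound `g`, depending on a constant `C₁`. -/
def g {n : ℕ} (C₁ : ℕ) (T : Finset (Fin n → ℤ)) (P : GenUnbProp n) : ℕ → ℕ
  | 0 => (2 * mu T P) ^ (n ^ C₁)
  | i + 1 => (2 * mu T P * (maxDec T * g C₁ T P i)) ^ (n ^ C₁) + g C₁ T P i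

end VAS

/-! The proof is an induction on the number of constrained components, in the style of Rackoff's
argument. The property is rewritten as a recursion `Sat` over stages: a stage is a walk `p` followed
by a walk `q` whose effect is tested against a tuple of intervals, and `M` collects the components
already released from the nonnegativity constraint.

Let `G i` bound the number of configurations for `i` constrained components, and put `B = maxDec T *
G i`. In the inductive step, suppose some constrained component `j` reaches `B`. Up to the first
such moment the constrained components stay in `[0, B)`, so removing cycles shortens that part to
length at most `B ^ n`. From there the remaining property can still be satisfied, even if the walk
was cut in the middle of `q`, because `q` can be run again (`Sat.exists_restart`). With `j`
disregarded, the induction hypothesis gives a continuation too short to bring `j` below zero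
(`Sat.of_erase`).

If no constrained component reaches `B` during a stage, its walks live in a finite cube. The walk
`p` loses its cycles. The walk `q` has an effect that matters, but only after truncation to `[-σ,
σ]`, where `σ` is the scale. It is split into a short core visiting all its nodes and a multiset of
short loops (`exists_core_loops`). A few of these loops already give the same truncated effect
(`exists_small_subset_truncate_eq`), and they are put back into the core (`exists_insert_loops`).

The selection of loops rests on a Steinitz-type argument: a family of bounded vectors can be ordered
so that all partial sums stay close to a segment, so in a long family with small total two partial
sums coincide and a zero-sum subfamily can be dropped. The resulting recurrence is dominated by `g`
with constant 5 (`stage_bound_le`). -/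

namespace VAS

/-! ### Steinitz-type selection of small subfamilies -/

section Steinitz

variable {ι : Type*}

/-- A combination with coefficients in `[0, 1]` can be rewritten with at most `finrank` many
coefficients in the open interval. -/
theorem exists_few_fractional [DecidableEq ι] {W : Type*} [AddCommGroup W] [Module ℚ W] [FiniteDimensional ℚ W]
    (A : Finset ι) (w : ι → W) (c : ι → ℚ) (hc : ∀ i ∈ A, 0 ≤ c i ∧ c i ≤ 1) :
    ∃ c' : ι → ℚ, (∀ i ∈ A, 0 ≤ c' i ∧ c' i ≤ 1) ∧ ∑ i ∈ A, c' i • w i = ∑ i ∈ A, c i • w i ∧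
      (A.filter fun i => 0 < c' i ∧ c' i < 1).card ≤ Module.finrank ℚ W := by
  induction hN : (A.filter fun i => 0 < c i ∧ c i < 1).card using Nat.strong_induction_on
    generalizing c with
  | _ N ih =>
  by_cases hle : N ≤ Module.finrank ℚ W
  · exact ⟨c, hc, rfl, hN ▸ hle⟩
  set F := A.filter fun i => 0 < c i ∧ c i < 1 with hF
  have hdep : ¬ LinearIndepOn ℚ w (F : Set ι) := by
    intro h
    have := LinearIndependent.fintype_card_le_finrank h
    simp at this
    omega
  rw [not_linearIndepOn_finset_iff] at hdep
  obtain ⟨b, hb0, i₀, hi₀, hbi₀⟩ := hdep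
  -- Coefficients move along `-b`; `r i` is the time at which the `i`-th one leaves `[0, 1]`.
  -- Stopping at the smallest such time makes one more coefficient integral and keeps the others
  -- admissible.
  let r : ι → ℚ := fun i => if 0 < b i then c i / b i else (1 - c i) / (-b i)
  obtain ⟨i₁, hi₁, hmin⟩ := Finset.exists_min_image (F.filter fun i => b i ≠ 0) r
    ⟨i₀, by simp [hi₀, hbi₀]⟩
  simp only [Finset.mem_filter] at hi₁ hmin
  obtain ⟨hi₁F, hbi₁⟩ := hi₁
  have hFm : ∀ i ∈ F, i ∈ A ∧ 0 < c i ∧ c i < 1 := fun i hi => by simpa [hF] using hi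
  have hr0 : ∀ i ∈ F, b i ≠ 0 → 0 < r i := by
    intro i hi hbi
    obtain ⟨-, h1, h2⟩ := hFm i hi
    by_cases hp : 0 < b i
    · simp only [r, if_pos hp]; positivity
    · simp only [r, if_neg hp]
      have : b i < 0 := lt_of_le_of_ne (not_lt.mp hp) hbi
      exact div_pos (by linarith) (by linarith)
  set t := r i₁ with ht
  have ht0 : 0 < t := hr0 i₁ hi₁F hbi₁
  let c' : ι → ℚ := fun i => if i ∈ F then c i - t * b i else c i
  have hc'F : ∀ i ∈ F, 0 ≤ c' i ∧ c' i ≤ 1 := by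
    intro i hi
    obtain ⟨-, h1, h2⟩ := hFm i hi
    simp only [c', if_pos hi]
    rcases lt_trichotomy (b i) 0 with hb | hb | hb
    · have h := hmin i ⟨hi, hb.ne⟩
      simp only [r, if_neg hb.le.not_gt] at h
      rw [le_div_iff₀ (by linarith)] at h
      constructor <;> nlinarith
    · simp [hb, h1.le, h2.le]
    · have h := hmin i ⟨hi, hb.ne'⟩
      simp only [r, if_pos hb] at h
      rw [le_div_iff₀ hb] at h
      constructor <;> nlinarith
  have hc'1 : c' i₁ = 0 ∨ c' i₁ = 1 := by
    simp only [c', if_pos hi₁F, ht, r]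
    rcases lt_or_gt_of_ne hbi₁ with hb | hb
    · right; rw [if_neg hb.le.not_gt]; field_simp; ring
    · left; rw [if_pos hb]; field_simp; ring
  have hc' : ∀ i ∈ A, 0 ≤ c' i ∧ c' i ≤ 1 := by
    intro i hi
    by_cases h : i ∈ F
    · exact hc'F i h
    · simpa [c', h] using hc i hi
  have hlt : (A.filter fun i => 0 < c' i ∧ c' i < 1).card < N := by
    rw [← hN]
    apply Finset.card_lt_card
    refine ⟨fun i hi => ?_, fun h => ?_⟩
    · by_contra hiF
      have hiF' := hiF
      simp only [Finset.mem_filter] at hi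
      simp only [hF, Finset.mem_filter, not_and] at hiF
      have h2 := hi.2
      simp only [c', if_neg hiF'] at h2
      exact hiF hi.1 h2.1 h2.2
    · have := h hi₁F
      simp only [Finset.mem_filter] at this
      rcases hc'1 with h | h <;> rw [h] at this <;> simp at this
  obtain ⟨c'', h1, h2, h3⟩ := ih _ hlt c' hc' rfl
  refine ⟨c'', h1, h2.trans ?_, h3⟩
  have hFA : A.filter (· ∈ F) = F := by
    ext i; simp only [Finset.mem_filter]; exact ⟨fun h => h.2, fun h => ⟨(hFm i h).1, h⟩⟩
  have : ∀ i, c' i • w i = c i • w i - if i ∈ F then t • (b i • w i) else 0 := by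
    intro i
    by_cases h : i ∈ F
    · simp [c', h, sub_smul, mul_smul]
    · simp [c', h]
  simp only [this, Finset.sum_sub_distrib]
  rw [← Finset.sum_filter, hFA, ← Finset.smul_sum, hb0]
  simp

/-- The invariant of the Steinitz chain: the sum over `A` is, up to total weight `n`, a
vanishing combination with coefficients in `[0, 1]`. -/
def Balanced {n : ℕ} (v : ι → Fin n → ℚ) (A : Finset ι) : Prop :=
  ∃ c : ι → ℚ, (∀ i ∈ A, 0 ≤ c i ∧ c i ≤ 1) ∧ ∑ i ∈ A, c i • v i = 0 ∧
    ∑ i ∈ A, c i = (A.card : ℚ) - n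

/-- Once the weights are lowered to the total required of a smaller set and made mostly integral,
some weight must be zero, and its index can be removed at no cost. -/
theorem Balanced.exists_erase [DecidableEq ι] {n : ℕ} {v : ι → Fin n → ℚ} {A : Finset ι} (h : Balanced v A)
    (hA : n + 1 ≤ A.card) : ∃ i ∈ A, Balanced v (A.erase i) := by
  obtain ⟨c, hc, hv, hs⟩ := h
  have hk : (n : ℚ) + 1 ≤ A.card := by exact_mod_cast hA
  set k : ℚ := (A.card : ℚ) with hkdef
  -- Scaling by `r` turns the total weight `k - n` into `k - 1 - n`, the value required after one
  -- erasure.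
  let r : ℚ := (k - 1 - n) / (k - n)
  have hr0 : 0 ≤ r := div_nonneg (by linarith) (by linarith)
  have hr1 : r ≤ 1 := div_le_one_of_le₀ (by linarith) (by linarith)
  -- The extra coordinate 1 makes the reduction preserve the total weight, at the price of dimension
  -- `n + 1`.
  obtain ⟨c', hc', hw, hcard⟩ := exists_few_fractional A (fun i => ((v i, 1) : (Fin n → ℚ) × ℚ))
    (fun i => r * c i) (fun i hi => ⟨mul_nonneg hr0 (hc i hi).1,
      mul_le_one₀ hr1 (hc i hi).1 (hc i hi).2⟩)
  have hdim : Module.finrank ℚ ((Fin n → ℚ) × ℚ) = n + 1 := by simp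
  rw [hdim] at hcard
  have hw1 : ∑ i ∈ A, c' i • v i = 0 := by
    have := congrArg Prod.fst hw
    simp only [Prod.fst_sum, Prod.smul_fst, mul_smul, ← Finset.smul_sum, hv] at this
    simpa using this
  have hw2 : ∑ i ∈ A, c' i = k - 1 - n := by
    have := congrArg Prod.snd hw
    simp only [Prod.snd_sum, Prod.smul_snd, smul_eq_mul, mul_one, ← Finset.mul_sum, hs] at this
    rw [this]
    have : k - n ≠ 0 := by linarith
    simp only [r]; field_simp
  -- Otherwise the total deficit `∑ (1 - c')`, equal to `n + 1`, is carried by at most `n + 1`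
  -- fractional coefficients, each contributing strictly less than 1.
  have hz : ∃ i ∈ A, c' i = 0 := by
    by_contra! hne
    set F := A.filter fun i => 0 < c' i ∧ c' i < 1 with hF
    have hsplit : ∑ i ∈ A, (1 - c' i) = ∑ i ∈ F, (1 - c' i) := by
      symm
      apply Finset.sum_subset (Finset.filter_subset _ _)
      intro i hi hiF
      have h1 := hc' i hi
      have h2 : 0 < c' i := lt_of_le_of_ne h1.1 (hne i hi).symm
      have : ¬ c' i < 1 := fun h => hiF (by simp [hi, h2, h])
      linarith
    have hsum : ∑ i ∈ A, (1 - c' i) = n + 1 := by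
      rw [Finset.sum_sub_distrib, hw2]; simp [hkdef]; ring
    have hF0 : F.Nonempty := by
      by_contra hF0
      rw [Finset.not_nonempty_iff_eq_empty] at hF0
      rw [hsum, hF0] at hsplit
      simp at hsplit
      have : (0 : ℚ) ≤ n := by positivity
      linarith
    have hlt : ∑ i ∈ F, (1 - c' i) < ∑ i ∈ F, (1 : ℚ) :=
      Finset.sum_lt_sum_of_nonempty hF0 fun i hi => by
        have := (Finset.mem_filter.mp hi).2.1
        linarith
    rw [← hsplit, hsum] at hlt
    simp at hlt
    have : (F.card : ℚ) ≤ n + 1 := by exact_mod_cast hcard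
    linarith
  obtain ⟨i, hi, hi0⟩ := hz
  refine ⟨i, hi, c', fun j hj => hc' j (Finset.mem_of_mem_erase hj), ?_, ?_⟩
  · rw [← hw1]; exact Finset.sum_erase _ (by simp [hi0])
  · rw [Finset.sum_erase _ hi0, hw2, Finset.card_erase_of_mem hi,
      Nat.cast_sub (by omega), hkdef]
    push_cast; ring

/-- Subtracting the vanishing combination leaves weights `1 - c i`, which are nonnegative and have
total exactly `n`. -/
theorem Balanced.abs_sum_le {n : ℕ} {v : ι → Fin n → ℚ} {A : Finset ι} (h : Balanced v A)
    {a : ℚ} (ha : ∀ i ∈ A, ∀ j, |v i j| ≤ a) (j : Fin n) : |∑ i ∈ A, v i j| ≤ n * a := by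
  obtain ⟨c, hc, hv, hs⟩ := h
  have hv' : ∑ i ∈ A, c i * v i j = 0 := by
    have := congrFun hv j
    simpa using this
  have h1 : ∑ i ∈ A, v i j = ∑ i ∈ A, (1 - c i) * v i j := by
    simp only [sub_mul, one_mul, Finset.sum_sub_distrib, hv', sub_zero]
  rw [h1]
  calc |∑ i ∈ A, (1 - c i) * v i j| ≤ ∑ i ∈ A, |(1 - c i) * v i j| := Finset.abs_sum_le_sum_abs _ _
    _ ≤ ∑ i ∈ A, (1 - c i) * a := Finset.sum_le_sum fun i hi => by
        have := hc i hi
        rw [abs_mul, abs_of_nonneg (by linarith : 0 ≤ 1 - c i)]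
        exact mul_le_mul_of_nonneg_left (ha i hi j) (by linarith)
    _ = n * a := by
        rw [← Finset.sum_mul, Finset.sum_sub_distrib, hs]; simp

theorem Balanced.exists_chain [DecidableEq ι] {n : ℕ} {v : ι → Fin n → ℚ} {s : Finset ι} (h : Balanced v s) :
    ∃ A : ℕ → Finset ι, A 0 = s ∧ Antitone A ∧
      ∀ m, m + n ≤ s.card → Balanced v (A m) ∧ (A m).card + m = s.card := by
  have hstep : ∀ X : Finset ι, ∃ Y : Finset ι, Y ⊆ X ∧
      (Balanced v X → n + 1 ≤ X.card → Balanced v Y ∧ Y.card + 1 = X.card) := by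
    intro X
    by_cases hX : Balanced v X ∧ n + 1 ≤ X.card
    · obtain ⟨i, hi, hb⟩ := hX.1.exists_erase hX.2
      exact ⟨X.erase i, Finset.erase_subset _ _, fun _ _ => ⟨hb, Finset.card_erase_add_one hi⟩⟩
    · exact ⟨X, subset_rfl, fun h1 h2 => absurd ⟨h1, h2⟩ hX⟩
  choose f hf1 hf2 using hstep
  refine ⟨fun m => f^[m] s, rfl, antitone_nat_of_succ_le fun m => ?_, fun m => ?_⟩
  · rw [Function.iterate_succ_apply']; exact hf1 _
  · induction m with
    | zero => intro _; exact ⟨h, rfl⟩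
    | succ m ih =>
      intro hm
      obtain ⟨h1, h2⟩ := ih (by omega)
      obtain ⟨h3, h4⟩ := hf2 _ h1 (by omega)
      simp only [Function.iterate_succ_apply']
      beta_reduce at h2 h4
      exact ⟨h3, by omega⟩

/-- A large family of bounded integer vectors with a small sum has a nonempty subfamily
with sum zero. -/
theorem exists_zero_sum {n : ℕ} (v : ι → Fin n → ℤ) (s : Finset ι) {a D : ℕ}
    (ha : ∀ i ∈ s, ∀ j, |v i j| ≤ a) (hD : ∀ j, |∑ i ∈ s, v i j| ≤ D)
    (hs : (2 * (D + 2 * a * n) + 1) ^ n + n < s.card + 1) (hn : n < s.card) :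
    ∃ t ⊆ s, t.Nonempty ∧ ∑ i ∈ t, v i = 0 := by
  classical
  set N : ℚ := (s.card : ℚ) with hN
  have hN0 : 0 < N := by rw [hN]; exact_mod_cast (by omega : 0 < s.card)
  have hnN : (n : ℚ) ≤ N := by rw [hN]; exact_mod_cast hn.le
  let d : Fin n → ℚ := fun j => ∑ i ∈ s, (v i j : ℚ)
  -- Centering at the mean makes the total zero, so constant weights `(N - n) / N` witness balance;
  -- it at most doubles the bound on entries.
  let w : ι → Fin n → ℚ := fun i j => v i j - d j / N
  have hdN : ∀ j, |d j| / N ≤ a := by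
    intro j
    rw [div_le_iff₀ hN0]
    calc |d j| ≤ ∑ i ∈ s, |(v i j : ℚ)| := Finset.abs_sum_le_sum_abs _ _
      _ ≤ ∑ i ∈ s, (a : ℚ) := Finset.sum_le_sum fun i hi => by exact_mod_cast ha i hi j
      _ = a * N := by simp [hN, mul_comm]
  have hwa : ∀ i ∈ s, ∀ j, |w i j| ≤ 2 * a := by
    intro i hi j
    have h1 : |(v i j : ℚ)| ≤ a := by exact_mod_cast ha i hi j
    have h2 := hdN j
    calc |w i j| ≤ |(v i j : ℚ)| + |d j / N| := abs_sub _ _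
      _ ≤ a + a := by rw [abs_div, abs_of_pos hN0]; exact add_le_add h1 h2
      _ = 2 * a := by ring
  have hbal : Balanced w s := by
    refine ⟨fun _ => (N - n) / N, fun i _ => ⟨div_nonneg (by linarith) hN0.le,
      div_le_one_of_le₀ (by linarith [(Nat.cast_nonneg n : (0 : ℚ) ≤ n)]) hN0.le⟩, ?_, ?_⟩
    · rw [← Finset.smul_sum]
      have : ∑ i ∈ s, w i = 0 := by
        ext j
        simp only [Finset.sum_apply, w, Finset.sum_sub_distrib, Finset.sum_const, nsmul_eq_mul,
          ← hN, Pi.zero_apply]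
        field_simp
        simp [d]
      rw [this, smul_zero]
    · simp only [Finset.sum_const, nsmul_eq_mul, ← hN]; field_simp
  obtain ⟨A, hA0, hAanti, hA⟩ := hbal.exists_chain
  have hAs : ∀ m, A m ⊆ s := fun m => hA0 ▸ hAanti (Nat.zero_le m)
  -- Each set of the chain has a sum within `2 * a * n` of a fraction of the total, and that
  -- fraction is at most `D` in absolute value. The chain has more sets than the box has points, and
  -- two nested sets with equal sums differ by a zero-sum family.
  let R : ℕ := D + 2 * a * n
  let box : Finset (Fin n → ℤ) := Finset.Icc (fun _ => -(R : ℤ)) (fun _ => (R : ℤ))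
  have hbox : box.card = (2 * R + 1) ^ n := by
    simp only [box, Pi.card_Icc, Int.card_Icc, Finset.prod_const, Finset.card_univ,
      Fintype.card_fin]
    congr 1
    omega
  have hmem : ∀ m ∈ Finset.range (s.card - n + 1), ∑ i ∈ A m, v i ∈ box := by
    intro m hm
    rw [Finset.mem_range] at hm
    obtain ⟨hb, hcard⟩ := hA m (by omega)
    have key : ∀ j, |∑ i ∈ A m, v i j| ≤ (R : ℤ) := by
      intro j
      have h1 := hb.abs_sum_le (a := 2 * a) (fun i hi => hwa i (hAs m hi)) j
      have h2 : (∑ i ∈ A m, (v i j : ℚ)) = ∑ i ∈ A m, w i j + (A m).card * (d j / N) := by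
        simp [w, Finset.sum_sub_distrib]
      have h3 : |((A m).card : ℚ) * (d j / N)| ≤ D := by
        have hcm : ((A m).card : ℚ) ≤ N := by
          rw [hN]; exact_mod_cast Finset.card_le_card (hAs m)
        have hDj : |d j| ≤ D := by
          have := hD j
          simp only [d]
          exact_mod_cast this
        rw [abs_mul, abs_div, abs_of_pos hN0, abs_of_nonneg (by positivity : (0 : ℚ) ≤ (A m).card),
          mul_div_assoc', div_le_iff₀ hN0]
        calc ((A m).card : ℚ) * |d j| ≤ N * D :=
              mul_le_mul hcm hDj (abs_nonneg _) hN0.le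
          _ = D * N := mul_comm _ _
      have h4 : |(∑ i ∈ A m, (v i j : ℚ))| ≤ (R : ℚ) := by
        rw [h2]
        refine (abs_add_le _ _).trans ((add_le_add h1 h3).trans (le_of_eq ?_))
        simp only [R]; push_cast; ring
      exact_mod_cast h4
    simp only [box, Finset.mem_Icc, Pi.le_def, Finset.sum_apply]
    exact ⟨fun j => (abs_le.mp (key j)).1, fun j => (abs_le.mp (key j)).2⟩
  obtain ⟨m, hm, m', hm', hne, heq⟩ := Finset.exists_ne_map_eq_of_card_lt_of_maps_to
    (by rw [hbox, Finset.card_range]; simp only [R]; omega) hmem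
  wlog hlt : m < m' generalizing m m'
  · exact this m' hm' m hm hne.symm heq.symm (by omega)
  rw [Finset.mem_range] at hm hm'
  have hsub : A m' ⊆ A m := hAanti hlt.le
  refine ⟨A m \ A m', Finset.sdiff_subset.trans (hAs m), ?_, ?_⟩
  · rw [← Finset.card_pos, Finset.card_sdiff_of_subset hsub]
    have h1 := (hA m (by omega)).2
    have h2 := (hA m' (by omega)).2
    omega
  · have := Finset.sum_sdiff (f := v) hsub
    rw [heq] at this
    exact add_eq_right.mp this

/-- The sum of a family of bounded integer vectors is the sum of a small subfamily. -/
theorem exists_small_subset_sum_eq [DecidableEq ι] {n : ℕ} (v : ι → Fin n → ℤ) (s : Finset ι) {a D : ℕ}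
    (ha : ∀ i ∈ s, ∀ j, |v i j| ≤ a) (hD : ∀ j, |∑ i ∈ s, v i j| ≤ D) :
    ∃ t ⊆ s, t.card ≤ (2 * (D + 2 * a * n) + 1) ^ n + n ∧ ∑ i ∈ t, v i = ∑ i ∈ s, v i := by
  induction hk : s.card using Nat.strong_induction_on generalizing s with
  | _ k ih =>
  by_cases hle : k ≤ (2 * (D + 2 * a * n) + 1) ^ n + n
  · exact ⟨s, subset_rfl, hk ▸ hle, rfl⟩
  -- Discarding a zero-sum subfamily leaves the total unchanged, so the bound `D` persists and the
  -- removal can be iterated.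
  obtain ⟨t, hts, htne, ht0⟩ := exists_zero_sum v s ha hD (by omega) (by omega)
  have hsum : ∑ i ∈ s \ t, v i = ∑ i ∈ s, v i := by
    rw [← Finset.sum_sdiff hts, ht0, add_zero]
  have hcard : (s \ t).card < k := by
    rw [Finset.card_sdiff_of_subset hts]
    have := htne.card_pos
    have := Finset.card_le_card hts
    omega
  obtain ⟨t', h1, h2, h3⟩ := ih _ hcard (s \ t)
    (fun i hi => ha i (Finset.mem_sdiff.mp hi).1) (fun j => by
      have := congrFun hsum j
      simp only [Finset.sum_apply] at this
      rw [this]; exact hD j) rfl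
  exact ⟨t', h1.trans Finset.sdiff_subset, h2, h3.trans hsum⟩

end Steinitz

/-! ### Selection up to truncation -/

/-- `d` and `d'` agree after truncation to `[-σ, σ]`. -/
def TruncEq (σ : ℕ) (d d' : ℤ) : Prop :=
  (|d| ≤ σ → d' = d) ∧ ((σ : ℤ) < d → (σ : ℤ) ≤ d') ∧ (d < -(σ : ℤ) → d' ≤ -(σ : ℤ))

/-- From a sum of bounded integer vectors with offset `z`, a small subfamily can be chosen whose
sum with offset `z` agrees with the original one after truncation to `[-σ, σ]`. -/
theorem exists_small_subset_truncate_eq {ι : Type*} {n : ℕ} (v : ι → Fin n → ℤ) (s : Finset ι)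
    (z : Fin n → ℤ) {a σ ζ : ℕ} (ha1 : 1 ≤ a) (ha : ∀ i ∈ s, ∀ j, |v i j| ≤ a)
    (hz : ∀ j, |z j| ≤ ζ) :
    ∃ t ⊆ s, t.card ≤ (2 * (σ + ζ + 2 * a * n) + 1) ^ n + n ∧
      ∀ j, TruncEq σ (∑ i ∈ s, v i j + z j) (∑ i ∈ t, v i j + z j) := by
  classical
  set d : Fin n → ℤ := fun j => ∑ i ∈ s, v i j + z j with hd
  let r : Fin n → ℕ := fun j => (|d j| - σ).toNat
  -- In each component, `r j` unit vectors opposite in sign to `d j` bring the total down to the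
  -- truncation of `d j`, hence within a bound independent of the family. Whichever of them are
  -- selected, leaving them out afterwards can only push the sum outwards past `σ` or `-σ`;
  -- components with `|d j| ≤ σ` have no slack and are reproduced exactly.
  let slack : Finset (Σ _ : Fin n, ℕ) := Finset.univ.sigma fun j => Finset.range (r j)
  let e : (Σ _ : Fin n, ℕ) → Fin n → ℤ := fun x => Pi.single x.1 (-(d x.1).sign)
  let w : ι ⊕ (Σ _ : Fin n, ℕ) → Fin n → ℤ := Sum.elim v e
  have hsign : ∀ k : ℤ, |k.sign| ≤ 1 := fun k => by
    rcases lt_trichotomy k 0 with h | h | h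
    · simp [Int.sign_eq_neg_one_of_neg h]
    · simp [h]
    · simp [Int.sign_eq_one_of_pos h]
  have hfull : ∀ j, ∑ x ∈ slack, e x j = -((r j : ℤ) * (d j).sign) := by
    intro j
    simp only [slack, e, Finset.sum_sigma, Finset.sum_const, Finset.card_range, nsmul_eq_mul,
      Pi.single_apply]
    simp
  have hterm : ∀ x ∈ slack, ∀ j, (|d j| ≤ σ → e x j = 0) ∧ ((σ : ℤ) < d j → e x j ≤ 0) ∧
      (d j < -(σ : ℤ) → 0 ≤ e x j) := by
    intro x hx j
    simp only [slack, Finset.mem_sigma, Finset.mem_univ, true_and, Finset.mem_range] at hx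
    by_cases hj : j = x.1
    · subst hj
      simp only [e, Pi.single_eq_same]
      refine ⟨fun h => ?_, fun h => ?_, fun h => ?_⟩
      · simp only [r] at hx; omega
      · rw [Int.sign_eq_one_of_pos (by omega)]; norm_num
      · rw [Int.sign_eq_neg_one_of_neg (by omega)]; norm_num
    · simp [e, hj]
  have hw : ∀ i ∈ s.disjSum slack, ∀ j, |w i j| ≤ a := by
    intro i hi j
    rcases i with i | x
    · exact ha i (by simpa using hi) j
    · simp only [w, Sum.elim_inr, e, Pi.single_apply]
      split_ifs
      · rw [abs_neg]; exact (hsign _).trans (by exact_mod_cast ha1)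
      · simp
  have htot : ∀ j, ∑ i ∈ s.disjSum slack, w i j = d j - (r j : ℤ) * (d j).sign - z j := by
    intro j
    rw [Finset.sum_disjSum]
    simp only [w, Sum.elim_inl, Sum.elim_inr, hfull, hd]
    ring
  have hclamp : ∀ j, (|d j| ≤ σ → d j - (r j : ℤ) * (d j).sign = d j) ∧
      ((σ : ℤ) < d j → d j - (r j : ℤ) * (d j).sign = σ) ∧
      (d j < -(σ : ℤ) → d j - (r j : ℤ) * (d j).sign = -σ) := by
    intro j
    simp only [r]
    refine ⟨fun h => ?_, fun h => ?_, fun h => ?_⟩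
    · rw [Int.toNat_of_nonpos (by omega)]; simp
    · rw [Int.sign_eq_one_of_pos (by omega), abs_of_pos (by omega)]; omega
    · rw [Int.sign_eq_neg_one_of_neg (by omega), abs_of_neg (by omega)]; omega
  have hD : ∀ j, |∑ i ∈ s.disjSum slack, w i j| ≤ (σ + ζ : ℕ) := by
    intro j
    have hzj := hz j
    rw [htot]
    obtain ⟨h1, h2, h3⟩ := hclamp j
    rw [abs_le] at hzj ⊢
    push_cast
    rcases le_or_gt |d j| σ with h | h
    · rw [h1 h]; rw [abs_le] at h; omega
    · rcases lt_abs.mp h with h | h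
      · rw [h2 h]; omega
      · rw [h3 (by omega)]; omega
  obtain ⟨t, hts, htc, hsum⟩ := exists_small_subset_sum_eq w _ hw hD
  have hL : t.toLeft ⊆ s := fun i hi => by simpa using hts (Finset.mem_toLeft.mp hi)
  have hR : t.toRight ⊆ slack := fun i hi => by simpa using hts (Finset.mem_toRight.mp hi)
  refine ⟨t.toLeft, hL, Finset.card_toLeft_le.trans htc, fun j => ?_⟩
  have hj : ∑ i ∈ t.toLeft, v i j + ∑ x ∈ t.toRight, e x j =
      d j - (r j : ℤ) * (d j).sign - z j := by
    rw [← htot]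
    have := congrFun hsum j
    simp only [Finset.sum_apply] at this
    rw [← this]
    conv_rhs => rw [← t.toLeft_disjSum_toRight]
    rw [Finset.sum_disjSum]
    simp [w]
  obtain ⟨h1, h2, h3⟩ := hclamp j
  change (|d j| ≤ σ → _ = d j) ∧ ((σ : ℤ) < d j → _) ∧ (d j < -(σ : ℤ) → _)
  refine ⟨fun h => ?_, fun h => ?_, fun h => ?_⟩
  · rw [h1 h, Finset.sum_eq_zero fun x hx => (hterm x (hR hx) j).1 h] at hj
    omega
  · have := Finset.sum_nonpos fun x hx => (hterm x (hR hx) j).2.1 h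
    rw [h2 h] at hj
    omega
  · have := Finset.sum_nonneg fun x hx => (hterm x (hR hx) j).2.2 h
    rw [h3 h] at hj
    omega

namespace TruncEq

variable {σ : ℕ} {d d' : ℤ}

/-- An interval containing a value above `σ` has no upper endpoint, and its lower endpoint, if any,
is at most `σ`; symmetrically below `-σ`. -/
theorem mem_toSet (h : TruncEq σ d d') {E : IntervalExpr} (hE : E.maxAbs ≤ σ)
    (hd : d ∈ E.toSet) : d' ∈ E.toSet := by
  obtain ⟨h1, h2, h3⟩ := h
  rcases le_or_gt |d| σ with h | h
  · rw [h1 h]; exact hd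
  rw [lt_abs] at h
  cases E <;> simp only [IntervalExpr.toSet, IntervalExpr.maxAbs, Set.mem_univ, Set.mem_Ici,
    Set.mem_Iic, Set.mem_Icc] at * <;> omega

theorem pos_iff (h : TruncEq σ d d') (hσ : 1 ≤ σ) : 0 < d' ↔ 0 < d := by
  obtain ⟨h1, h2, h3⟩ := h
  rcases le_or_gt |d| σ with h | h
  · rw [h1 h]
  · rw [lt_abs] at h; omega

theorem nonneg_iff (h : TruncEq σ d d') (hσ : 1 ≤ σ) : 0 ≤ d' ↔ 0 ≤ d := by
  obtain ⟨h1, h2, h3⟩ := h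
  rcases le_or_gt |d| σ with h | h
  · rw [h1 h]
  · rw [lt_abs] at h; omega

end TruncEq

/-! ### Walks, cores and loops -/

section Loops

theorem prefix_append_cases {α : Type*} {a p q : List α} (h : a <+: p ++ q) :
    a <+: p ∨ ∃ b, b <+: q ∧ a = p ++ b := by
  obtain ⟨e, he⟩ := h
  rcases List.append_eq_append_iff.mp he with ⟨b, rfl, rfl⟩ | ⟨b, rfl, rfl⟩
  · exact Or.inl ⟨b, rfl⟩
  · exact Or.inr ⟨b, ⟨e, rfl⟩, rfl⟩

theorem strict_prefix_append_cases {α : Type*} {a p q : List α} (h : a <+: p ++ q)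
    (hne : a ≠ p ++ q) : (a <+: p ∧ a ≠ p) ∨ ∃ b, b <+: q ∧ b ≠ q ∧ a = p ++ b := by
  rcases prefix_append_cases h with h1 | ⟨b, hb, rfl⟩
  · by_cases hap : a = p
    · subst hap
      exact Or.inr ⟨[], List.nil_prefix, fun h0 => hne (by simp [← h0]), by simp⟩
    · exact Or.inl ⟨h1, hap⟩
  · exact Or.inr ⟨b, hb, fun h0 => hne (by rw [h0]), rfl⟩

variable {G H : Type*} [AddCommGroup G] [AddCommGroup H] (π : G →+ H)

theorem length_lt_card_of_injOn {S : Finset H} {x : H} {c : List G}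
    (hS : ∀ a, a <+: c → x + π a.sum ∈ S)
    (hinj : ∀ a b, a <+: c → b <+: c → π a.sum = π b.sum → a = b) : c.length + 1 ≤ S.card := by
  rw [← Finset.card_range (c.length + 1)]
  refine Finset.card_le_card_of_injOn (fun m => x + π (c.take m).sum)
    (fun m _ => hS _ (List.take_prefix _ _)) ?_
  intro m hm m' hm' h
  have := hinj _ _ (List.take_prefix m c) (List.take_prefix m' c) (by simpa using h)
  have := congrArg List.length this
  simp only [Finset.coe_range, Set.mem_Iio] at hm hm'
  simp only [List.length_take] at this
  omega

/-- Appending a letter to a walk with distinct nodes either closes a loop or keeps the nodes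
distinct. -/
theorem injOn_concat {c : List G} {t : G}
    (hinj : ∀ a b, a <+: c → b <+: c → π a.sum = π b.sum → a = b)
    (hnew : ¬ ∃ a, a <+: c ∧ π a.sum = π (c ++ [t]).sum) :
    ∀ a b, a <+: c ++ [t] → b <+: c ++ [t] → π a.sum = π b.sum → a = b := by
  intro a b ha hb hab
  rw [List.prefix_concat_iff] at ha hb
  rcases ha with rfl | ha <;> rcases hb with rfl | hb
  · rfl
  · exact absurd ⟨b, hb, hab.symm⟩ hnew
  · exact absurd ⟨a, ha, hab⟩ hnew
  · exact hinj a b ha hb hab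

/-- A walk can be shortened to one without repeated nodes. -/
theorem exists_short_walk (S : Finset H) (x : H) (p : List G)
    (hp : ∀ a, a <+: p → x + π a.sum ∈ S) :
    ∃ p' : List G, p' ⊆ p ∧ (∀ a, a <+: p' → x + π a.sum ∈ S) ∧ π p'.sum = π p.sum ∧
      p'.length + 1 ≤ S.card := by
  suffices h : ∃ p' : List G, p' ⊆ p ∧ (∀ a, a <+: p' → x + π a.sum ∈ S) ∧ π p'.sum = π p.sum ∧
      ∀ a b, a <+: p' → b <+: p' → π a.sum = π b.sum → a = b by
    obtain ⟨p', h1, h2, h3, h4⟩ := h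
    exact ⟨p', h1, h2, h3, length_lt_card_of_injOn π h2 h4⟩
  induction p using List.reverseRecOn with
  | nil =>
    refine ⟨[], List.Subset.refl _, hp, rfl, fun a b ha hb _ => ?_⟩
    rw [List.prefix_nil.mp ha, List.prefix_nil.mp hb]
  | append_singleton p t ih =>
    obtain ⟨p', h1, h2, h3, h4⟩ := ih fun a ha => hp a (ha.trans (List.prefix_append _ _))
    have hsum : π (p' ++ [t]).sum = π (p ++ [t]).sum := by simp [h3]
    by_cases hrep : ∃ a, a <+: p' ∧ π a.sum = π (p' ++ [t]).sum
    · obtain ⟨a, ha, hat⟩ := hrep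
      exact ⟨a, List.Subset.trans (List.Subset.trans ha.subset h1) (List.subset_append_left _ _),
        fun b hb => h2 b (hb.trans ha), hat.trans hsum,
        fun b e hb he => h4 b e (hb.trans ha) (he.trans ha)⟩
    · refine ⟨p' ++ [t], List.append_subset.mpr ⟨List.Subset.trans h1 (List.subset_append_left _ _),
        List.subset_append_right _ _⟩, fun a ha => ?_, hsum, injOn_concat π h4 hrep⟩
      rw [List.prefix_concat_iff] at ha
      rcases ha with rfl | ha
      · rw [hsum]; exact hp _ (List.prefix_refl _)
      · exact h2 a ha

/-- `w` is a loop of length at most `N` through nodes in `V`. -/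
def IsLoop (V : Finset H) (N : ℕ) (w : List G) : Prop :=
  π w.sum = 0 ∧ w.length ≤ N ∧ ∃ y ∈ V, ∀ a, a <+: w → y + π a.sum ∈ V

variable {π} in
theorem IsLoop.mono {V V' : Finset H} {N : ℕ} {w : List G} (h : IsLoop π V N w) (hV : V ⊆ V') :
    IsLoop π V' N w := by
  obtain ⟨h1, h2, y, hy, h3⟩ := h
  exact ⟨h1, h2, y, hV hy, fun a ha => hV (h3 a ha)⟩

/-- A walk decomposes into a short walk through the same nodes and short loops. -/
theorem exists_core_loops [DecidableEq H] (S : Finset H) (x : H) (q : List G)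
    (hq : ∀ a, a <+: q → x + π a.sum ∈ S) :
    ∃ (c : List G) (ls : List (List G)) (V : Finset H), c ⊆ q ∧ (∀ w ∈ ls, w ⊆ q) ∧ V ⊆ S ∧
      (∀ a, a <+: c → x + π a.sum ∈ V) ∧ (∀ y ∈ V, ∃ a, a <+: c ∧ x + π a.sum = y) ∧
      c.length ≤ S.card * S.card ∧ q.sum = c.sum + (ls.map List.sum).sum ∧
      ∀ w ∈ ls, IsLoop π V S.card w := by
  set N := S.card with hN
  -- Invariant for reading `q` letter by letter: `c₁` visits exactly the nodes of `V`, and `c₂` is a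
  -- simple walk inside `V` that continues it. A new letter closes a loop, which is split off, or
  -- extends `c₂`, or reaches a new node; in the last case `c₂` is absorbed into `c₁`. Since `c₂` is
  -- simple, each new node costs at most `N` letters.
  suffices h : ∃ (c₁ c₂ : List G) (ls : List (List G)) (V : Finset H), c₁ ⊆ q ∧ c₂ ⊆ q ∧
      (∀ w ∈ ls, w ⊆ q) ∧ V ⊆ S ∧
      (∀ a, a <+: c₁ → x + π a.sum ∈ V) ∧ (∀ y ∈ V, ∃ a, a <+: c₁ ∧ x + π a.sum = y) ∧
      (∀ a, a <+: c₂ → x + π c₁.sum + π a.sum ∈ V) ∧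
      (∀ a b, a <+: c₂ → b <+: c₂ → π a.sum = π b.sum → a = b) ∧
      c₁.length + N ≤ N * V.card ∧ q.sum = c₁.sum + c₂.sum + (ls.map List.sum).sum ∧
      ∀ w ∈ ls, IsLoop π V N w by
    obtain ⟨c₁, c₂, ls, V, h1, h2, h3, h4, h5, h6, h7, h8, h9, h10, h11⟩ := h
    refine ⟨c₁ ++ c₂, ls, V, List.append_subset.mpr ⟨h1, h2⟩, h3, h4, ?_, ?_, ?_, by simpa, h11⟩
    · intro a ha
      rcases prefix_append_cases ha with ha | ⟨b, hb, rfl⟩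
      · exact h5 a ha
      · have := h7 b hb
        rwa [add_assoc, ← map_add, ← List.sum_append] at this
    · intro y hy
      obtain ⟨a, ha, rfl⟩ := h6 y hy
      exact ⟨a, ha.trans (List.prefix_append _ _), rfl⟩
    · have hc₂ := length_lt_card_of_injOn π h7 h8
      have hVN : V.card ≤ N := Finset.card_le_card h4
      have := Nat.mul_le_mul_left N hVN
      rw [List.length_append]
      omega
  induction q using List.reverseRecOn with
  | nil =>
    have hx : x ∈ S := by simpa using hq [] (List.prefix_refl _)
    refine ⟨[], [], [], {x}, by simp, by simp, by simp, by simpa using hx, ?_, ?_, ?_, ?_, by simp,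
      by simp, by simp⟩
    · intro a ha; simp [List.prefix_nil.mp ha]
    · intro y hy; exact ⟨[], List.prefix_refl _, by simp_all⟩
    · intro a ha; simp [List.prefix_nil.mp ha]
    · intro a b ha hb _; rw [List.prefix_nil.mp ha, List.prefix_nil.mp hb]
  | append_singleton q t ih =>
    obtain ⟨c₁, c₂, ls, V, h1, h2, h3, h4, h5, h6, h7, h8, h9, h10, h11⟩ :=
      ih fun a ha => hq a (ha.trans (List.prefix_append _ _))
    have hqt : q ⊆ q ++ [t] := List.subset_append_left _ _
    have htq : [t] ⊆ q ++ [t] := List.subset_append_right _ _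
    have hls0 : π (ls.map List.sum).sum = 0 := by
      rw [map_list_sum]
      apply List.sum_eq_zero
      intro y hy
      simp only [List.mem_map] at hy
      obtain ⟨_, ⟨w, hw, rfl⟩, rfl⟩ := hy
      exact (h11 w hw).1
    have hend : x + π (q ++ [t]).sum = x + π c₁.sum + π (c₂ ++ [t]).sum := by
      simp only [List.sum_append, map_add, h10, hls0, add_zero]
      abel
    have hyS := hq _ (List.prefix_refl _)
    rw [hend] at hyS
    have hc₂ := length_lt_card_of_injOn π h7 h8
    have hVN : V.card ≤ N := Finset.card_le_card h4
    by_cases hyV : x + π c₁.sum + π (c₂ ++ [t]).sum ∈ V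
    · by_cases hrep : ∃ a, a <+: c₂ ∧ π a.sum = π (c₂ ++ [t]).sum
      · obtain ⟨a, ⟨b, rfl⟩, hat⟩ := hrep
        have hloop0 : π (b ++ [t]).sum = 0 := by
          rw [List.append_assoc, List.sum_append, map_add] at hat
          exact left_eq_add.mp hat
        have hap : a <+: a ++ b := List.prefix_append _ _
        refine ⟨c₁, a, (b ++ [t]) :: ls, V, List.Subset.trans h1 hqt, List.Subset.trans (List.Subset.trans hap.subset h2) hqt, ?_, h4,
          h5, h6, fun e he => h7 e (he.trans hap),
          fun e f he hf => h8 e f (he.trans hap) (hf.trans hap), h9, ?_, ?_⟩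
        · intro w hw
          rcases List.mem_cons.mp hw with rfl | hw
          · exact List.append_subset.mpr
              ⟨List.Subset.trans (List.Subset.trans (List.subset_append_right _ _) h2) hqt, htq⟩
          · exact List.Subset.trans (h3 w hw) hqt
        · simp only [List.sum_append, List.map_cons, List.sum_cons, h10]
          abel
        · intro w hw
          rcases List.mem_cons.mp hw with rfl | hw
          · refine ⟨hloop0, ?_, x + π c₁.sum + π a.sum, h7 a hap, fun e he => ?_⟩
            · simp only [List.length_append, List.length_singleton] at hc₂ ⊢
              omega
            · rw [List.prefix_concat_iff] at he
              rcases he with rfl | he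
              · rw [hloop0, add_zero]; exact h7 a hap
              · have := h7 (a ++ e) ((List.prefix_append_right_inj a).mpr he)
                rwa [List.sum_append, map_add, ← add_assoc] at this
          · exact h11 w hw
      · refine ⟨c₁, c₂ ++ [t], ls, V, List.Subset.trans h1 hqt, List.append_subset.mpr ⟨List.Subset.trans h2 hqt, htq⟩,
          fun w hw => List.Subset.trans (h3 w hw) hqt, h4, h5, h6, fun a ha => ?_, injOn_concat π h8 hrep, h9,
          ?_, h11⟩
        · rw [List.prefix_concat_iff] at ha
          rcases ha with rfl | ha
          · exact hyV
          · exact h7 a ha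
        · simp only [List.sum_append, h10]
          abel
    · have hsum : x + π (c₁ ++ (c₂ ++ [t])).sum = x + π c₁.sum + π (c₂ ++ [t]).sum := by
        rw [List.sum_append, map_add, add_assoc]
      have hVV : V ⊆ insert (x + π c₁.sum + π (c₂ ++ [t]).sum) V := Finset.subset_insert _ _
      refine ⟨c₁ ++ (c₂ ++ [t]), [], ls, insert (x + π c₁.sum + π (c₂ ++ [t]).sum) V,
        List.append_subset.mpr ⟨List.Subset.trans h1 hqt, List.append_subset.mpr ⟨List.Subset.trans h2 hqt, htq⟩⟩,
        by simp, fun w hw => List.Subset.trans (h3 w hw) hqt, Finset.insert_subset hyS h4, ?_, ?_, ?_, ?_, ?_,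
        ?_, fun w hw => (h11 w hw).mono hVV⟩
      · intro a ha
        rw [← List.append_assoc, List.prefix_concat_iff, List.append_assoc] at ha
        rcases ha with rfl | ha
        · rw [hsum]; exact Finset.mem_insert_self _ _
        · apply hVV
          rcases prefix_append_cases ha with ha | ⟨b, hb, rfl⟩
          · exact h5 a ha
          · have := h7 b hb
            rwa [add_assoc, ← map_add, ← List.sum_append] at this
      · intro y hy
        rcases Finset.mem_insert.mp hy with rfl | hy
        · exact ⟨_, List.prefix_refl _, hsum⟩
        · obtain ⟨a, ha, hay⟩ := h6 y hy
          exact ⟨a, ha.trans (List.prefix_append _ _), hay⟩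
      · intro a ha
        rw [List.prefix_nil.mp ha, hsum]
        simp
      · intro a b ha hb _; rw [List.prefix_nil.mp ha, List.prefix_nil.mp hb]
      · rw [Finset.card_insert_of_notMem hyV, Nat.mul_add]
        simp only [List.length_append, List.length_singleton]
        omega
      · simp only [List.sum_append, h10, List.sum_nil]
        abel

/-- Loops based at nodes of a walk can be inserted into it. -/
theorem exists_insert_loops (V : Finset H) (N : ℕ) (x : H) (c : List G)
    (hc : ∀ a, a <+: c → x + π a.sum ∈ V) (hV : ∀ y ∈ V, ∃ a, a <+: c ∧ x + π a.sum = y)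
    (ls : List (List G)) (hls : ∀ w ∈ ls, IsLoop π V N w) :
    ∃ c' : List G, (∀ t ∈ c', t ∈ c ∨ ∃ w ∈ ls, t ∈ w) ∧ (∀ a, a <+: c' → x + π a.sum ∈ V) ∧
      (∀ y ∈ V, ∃ a, a <+: c' ∧ x + π a.sum = y) ∧
      c'.sum = c.sum + (ls.map List.sum).sum ∧ c'.length ≤ c.length + N * ls.length := by
  induction ls with
  | nil => exact ⟨c, fun t ht => Or.inl ht, hc, hV, by simp, by simp⟩
  | cons w ls ih =>
    obtain ⟨c', h1, h2, h3, h4, h5⟩ := ih fun w hw => hls w (List.mem_cons_of_mem _ hw)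
    obtain ⟨hw0, hwN, y, hy, hwV⟩ := hls w List.mem_cons_self
    -- The walk still visits all of `V`, so it can be cut at the base node of the next loop; the
    -- loop has zero projection, so the nodes after the cut do not move.
    obtain ⟨a, ⟨b, rfl⟩, rfl⟩ := h3 y hy
    refine ⟨a ++ (w ++ b), ?_, ?_, ?_, ?_, ?_⟩
    · intro t ht
      simp only [List.mem_append] at ht h1
      rcases ht with ht | ht | ht
      · rcases h1 t (Or.inl ht) with h | ⟨w', hw', h⟩
        · exact Or.inl h
        · exact Or.inr ⟨w', List.mem_cons_of_mem _ hw', h⟩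
      · exact Or.inr ⟨w, List.mem_cons_self, ht⟩
      · rcases h1 t (Or.inr ht) with h | ⟨w', hw', h⟩
        · exact Or.inl h
        · exact Or.inr ⟨w', List.mem_cons_of_mem _ hw', h⟩
    · intro e he
      rcases prefix_append_cases he with he | ⟨f, hf, rfl⟩
      · exact h2 e (he.trans (List.prefix_append _ _))
      · rcases prefix_append_cases hf with hf | ⟨g, hg, rfl⟩
        · have := hwV f hf
          rwa [add_assoc, ← map_add, ← List.sum_append] at this
        · have := h2 (a ++ g) ((List.prefix_append_right_inj a).mpr hg)
          simpa [hw0] using this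
    · intro y hy
      obtain ⟨e, he, rfl⟩ := h3 y hy
      rcases prefix_append_cases he with he | ⟨f, hf, rfl⟩
      · exact ⟨e, he.trans (List.prefix_append _ _), rfl⟩
      · exact ⟨a ++ (w ++ f), (List.prefix_append_right_inj a).mpr
          ((List.prefix_append_right_inj w).mpr hf), by simp [hw0]⟩
    · simp only [List.sum_append, List.map_cons, List.sum_cons] at h4 ⊢
      rw [← sub_eq_zero] at h4 ⊢
      rw [← h4]
      abel
    · simp only [List.length_append, List.length_cons, Nat.mul_add] at h5 ⊢
      omega

end Loops

/-! ### Shortening the walks of a bounded stage -/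

section Stage

variable {n : ℕ}

/-- Set all coordinates outside `J` to zero. -/
def proj (J : Finset (Fin n)) : (Fin n → ℤ) →+ (Fin n → ℤ) where
  toFun v j := if j ∈ J then v j else 0
  map_zero' := by ext; simp
  map_add' v w := by ext j; by_cases h : j ∈ J <;> simp [h]

theorem proj_apply (J : Finset (Fin n)) (v : Fin n → ℤ) (j : Fin n) :
    proj J v j = if j ∈ J then v j else 0 := rfl

theorem proj_eq_iff {J : Finset (Fin n)} {v w : Fin n → ℤ} :
    proj J v = proj J w ↔ ∀ j ∈ J, v j = w j := by
  constructor
  · intro h j hj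
    simpa [proj_apply, hj] using congrFun h j
  · intro h
    ext j
    by_cases hj : j ∈ J
    · simp [proj_apply, hj, h j hj]
    · simp [proj_apply, hj]

/-- The vectors supported on `J` with values in `[0, B - 1]`. -/
noncomputable def cube (J : Finset (Fin n)) (B : ℕ) : Finset (Fin n → ℤ) :=
  Finset.Icc 0 fun j => if j ∈ J then (B : ℤ) - 1 else 0

theorem card_cube_le (J : Finset (Fin n)) {B : ℕ} (hB : 1 ≤ B) : (cube J B).card ≤ B ^ n := by
  rw [cube, Pi.card_Icc]
  calc _ ≤ ∏ _j : Fin n, B := Finset.prod_le_prod' fun j _ => by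
        by_cases hj : j ∈ J <;> simp [hj, hB]
    _ = B ^ n := by simp

theorem proj_mem_cube {J : Finset (Fin n)} {B : ℕ} {v : Fin n → ℤ} :
    proj J v ∈ cube J B ↔ ∀ j ∈ J, 0 ≤ v j ∧ v j < B := by
  simp only [cube, Finset.mem_Icc, Pi.le_def, proj_apply, ← forall_and]
  refine forall_congr' fun j => ?_
  by_cases hj : j ∈ J <;> simp [hj]

theorem abs_apply_le_absMax {T : Finset (Fin n → ℤ)} {t : Fin n → ℤ} (ht : t ∈ T) (j : Fin n) :
    |t j| ≤ absMax T := by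
  have h1 : (t j).natAbs ≤ Finset.univ.sup fun i : Fin n => (t i).natAbs :=
    Finset.le_sup (f := fun i : Fin n => (t i).natAbs) (Finset.mem_univ j)
  have h2 : (Finset.univ.sup fun i : Fin n => (t i).natAbs) ≤ absMax T :=
    Finset.le_sup (f := fun b : Fin n → ℤ => Finset.univ.sup fun i : Fin n => (b i).natAbs) ht
  rw [Int.abs_eq_natAbs]
  exact_mod_cast h1.trans h2

theorem abs_list_sum_le {T : Finset (Fin n → ℤ)} {p : List (Fin n → ℤ)} (hp : ∀ t ∈ p, t ∈ T)
    (j : Fin n) : |p.sum j| ≤ absMax T * p.length := by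
  induction p with
  | nil => simp
  | cons t p ih =>
    have h1 := ih fun s hs => hp s (List.mem_cons_of_mem _ hs)
    have h2 := abs_apply_le_absMax (hp t List.mem_cons_self) j
    rw [List.sum_cons, Pi.add_apply, List.length_cons]
    push_cast
    calc |t j + p.sum j| ≤ |t j| + |p.sum j| := abs_add_le _ _
      _ ≤ absMax T * ((p.length : ℤ) + 1) := by linarith

/-- A walk whose strict prefixes are bounded on `J` can be shortened without changing its effect
on `J`. -/
theorem exists_short_bounded_walk (J : Finset (Fin n)) {B : ℕ} (hB : 1 ≤ B) (u : Fin n → ℤ)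
    (p : List (Fin n → ℤ))
    (hp : ∀ a, a <+: p → a ≠ p → ∀ j ∈ J, 0 ≤ u j + a.sum j ∧ u j + a.sum j < B) :
    ∃ p' : List (Fin n → ℤ), p' ⊆ p ∧ (∀ a, a <+: p' → a ≠ p' → ∀ j ∈ J, 0 ≤ u j + a.sum j) ∧
      (∀ j ∈ J, p'.sum j = p.sum j) ∧ p'.length ≤ B ^ n := by
  -- The endpoint need not lie in the cube, so the last letter is kept aside and only the walk
  -- before it is shortened.
  rcases List.eq_nil_or_concat' p with rfl | ⟨p, t, rfl⟩
  · refine ⟨[], List.Subset.refl _, fun a ha hne => absurd (List.prefix_nil.mp ha) hne, by simp,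
      by simp⟩
  obtain ⟨p', h1, h2, h3, h4⟩ := exists_short_walk (proj J) (cube J B) (proj J u) p fun a ha => by
    rw [← map_add, proj_mem_cube]
    refine hp a (ha.trans (List.prefix_append _ _)) ?_
    rintro rfl
    simpa using ha.length_le
  refine ⟨p' ++ [t], List.append_subset.mpr ⟨List.Subset.trans h1 (List.subset_append_left _ _),
    List.subset_append_right _ _⟩, ?_, ?_, ?_⟩
  · intro a ha hne j hj
    have := h2 a ((List.prefix_concat_iff.mp ha).resolve_left hne)
    rw [← map_add, proj_mem_cube] at this
    exact (this j hj).1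
  · intro j hj
    simp [proj_eq_iff.mp h3 j hj]
  · rw [List.length_append, List.length_singleton]
    exact h4.trans (card_cube_le J hB)

/-- The bound for the length of the pumped part of a stage. -/
def segmentBound (n τ σ M : ℕ) : ℕ :=
  M * M + M * ((2 * (σ + τ * (M * M + 1) + 2 * (τ * M) * n) + 1) ^ n + n) + 1

/-- A walk whose strict prefixes are bounded on `J` can be shortened without changing its effect
on `J` nor its truncated effect. -/
theorem exists_short_segment {T : Finset (Fin n → ℤ)} (hT : 1 ≤ absMax T) (J : Finset (Fin n))
    {B : ℕ} (hB : 1 ≤ B) (σ : ℕ) (u : Fin n → ℤ) (q : List (Fin n → ℤ)) (hqT : ∀ t ∈ q, t ∈ T)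
    (hq : ∀ a, a <+: q → a ≠ q → ∀ j ∈ J, 0 ≤ u j + a.sum j ∧ u j + a.sum j < B) :
    ∃ q' : List (Fin n → ℤ), (∀ t ∈ q', t ∈ T) ∧
      (∀ a, a <+: q' → a ≠ q' → ∀ j ∈ J, 0 ≤ u j + a.sum j) ∧
      (∀ j ∈ J, q'.sum j = q.sum j) ∧ (∀ j, TruncEq σ (q.sum j) (q'.sum j)) ∧
      q'.length ≤ segmentBound n (absMax T) σ (B ^ n) := by
  rcases List.eq_nil_or_concat' q with rfl | ⟨q, t, rfl⟩
  · refine ⟨[], by simp, fun a ha hne => absurd (List.prefix_nil.mp ha) hne, by simp, ?_, by simp⟩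
    intro j
    change (_ → (0 : ℤ) = 0) ∧ ((σ : ℤ) < 0 → (σ : ℤ) ≤ 0) ∧ ((0 : ℤ) < -(σ : ℤ) → (0 : ℤ) ≤ -(σ : ℤ))
    exact ⟨fun _ => rfl, by omega, by omega⟩
  have hM1 : 1 ≤ B ^ n := Nat.one_le_pow _ _ hB
  have hcube := card_cube_le J hB
  set M := B ^ n with hM
  set τ := absMax T with hτ
  obtain ⟨c, ls, V, hcq, hlsq, hVS, hcV, hVc, hcl, hsum, hloop⟩ :=
    exists_core_loops (proj J) (cube J B) (proj J u) q fun a ha => by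
      rw [← map_add, proj_mem_cube]
      refine hq a (ha.trans (List.prefix_append _ _)) ?_
      rintro rfl
      simpa using ha.length_le
  have hqT' : ∀ s ∈ q, s ∈ T := fun s hs => hqT s (by simp [hs])
  have htT : t ∈ T := hqT t (by simp)
  have hv : ∀ i ∈ (Finset.univ : Finset (Fin ls.length)), ∀ j, |(ls[i]).sum j| ≤ (τ * M : ℕ) := by
    intro i _ j
    have hi : ls[i] ∈ ls := List.getElem_mem _
    refine (abs_list_sum_le (fun s hs => hqT' s (hlsq _ hi hs)) j).trans ?_
    push_cast
    have : ((ls[i]).length : ℤ) ≤ M := by exact_mod_cast (hloop _ hi).2.1.trans hcube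
    exact mul_le_mul_of_nonneg_left this (by positivity)
  have hcl' : c.length ≤ M * M := hcl.trans (Nat.mul_le_mul hcube hcube)
  have hz : ∀ j, |(c ++ [t]).sum j| ≤ (τ * (M * M + 1) : ℕ) := by
    intro j
    refine (abs_list_sum_le (T := T) (fun s hs => ?_) j).trans ?_
    · rcases List.mem_append.mp hs with h | h
      · exact hqT' s (hcq h)
      · rw [List.mem_singleton.mp h]; exact htT
    · rw [List.length_append, List.length_singleton]
      exact_mod_cast Nat.mul_le_mul_left _ (by omega)
  -- Core and last letter are kept, so their joint effect enters as the fixed offset; only the loops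
  -- are selected.
  obtain ⟨I, -, hIc, hI⟩ := exists_small_subset_truncate_eq (fun i : Fin ls.length => (ls[i]).sum)
    Finset.univ (c ++ [t]).sum (σ := σ) (Nat.mul_pos hT hM1) hv hz
  obtain ⟨c', hc'1, hc'2, -, hc'3, hc'4⟩ := exists_insert_loops (proj J) V _ (proj J u) c hcV hVc
    (I.toList.map fun i => ls[i]) (by
      intro w hw
      obtain ⟨i, -, rfl⟩ := List.mem_map.mp hw
      exact hloop _ (List.getElem_mem _))
  have hsumI : ((I.toList.map fun i => ls[i]).map List.sum).sum = ∑ i ∈ I, (ls[i]).sum := by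
    rw [List.map_map, ← Finset.sum_map_toList]; rfl
  have hsumU : (ls.map List.sum).sum = ∑ i : Fin ls.length, (ls[i]).sum :=
    (Fin.sum_univ_fun_getElem ls List.sum).symm
  have hJ0 : ∀ i : Fin ls.length, ∀ j ∈ J, (ls[i]).sum j = 0 := by
    intro i j hj
    have := (hloop ls[i] (List.getElem_mem _)).1
    rw [← map_zero (proj J), proj_eq_iff] at this
    exact this j hj
  have hc't : ∀ j, (c' ++ [t]).sum j = ∑ i ∈ I, (ls[i]).sum j + (c ++ [t]).sum j := by
    intro j
    rw [List.sum_append, hc'3, hsumI]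
    simp only [Pi.add_apply, Finset.sum_apply, List.sum_append]
    ring
  have hqt : ∀ j, (q ++ [t]).sum j = ∑ i : Fin ls.length, (ls[i]).sum j + (c ++ [t]).sum j := by
    intro j
    rw [List.sum_append, hsum, hsumU]
    simp only [Pi.add_apply, Finset.sum_apply, List.sum_append]
    ring
  refine ⟨c' ++ [t], ?_, ?_, ?_, ?_, ?_⟩
  · intro s hs
    rcases List.mem_append.mp hs with h | h
    · rcases hc'1 s h with h | ⟨w, hw, h⟩
      · exact hqT' s (hcq h)
      · obtain ⟨i, -, rfl⟩ := List.mem_map.mp hw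
        exact hqT' s (hlsq _ (List.getElem_mem _) h)
    · rw [List.mem_singleton.mp h]; exact htT
  · intro a ha hne j hj
    have := hVS (hc'2 a ((List.prefix_concat_iff.mp ha).resolve_left hne))
    rw [← map_add, proj_mem_cube] at this
    exact (this j hj).1
  · intro j hj
    rw [hc't, hqt, Finset.sum_eq_zero fun i _ => hJ0 i j hj,
      Finset.sum_eq_zero fun i _ => hJ0 i j hj]
  · intro j
    rw [hc't, hqt]
    exact hI j
  · rw [List.length_append, List.length_singleton, segmentBound]
    rw [List.length_map, Finset.length_toList] at hc'4
    have := Nat.mul_le_mul hcube hIc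
    omega

end Stage

/-! ### The recursive property and the Rackoff induction -/

section Sat

variable {n : ℕ}

/-- The components that may decrease after a stage with effect `d`. -/
def release (M : Finset (Fin n)) (d : Fin n → ℤ) : Finset (Fin n) :=
  M ∪ Finset.univ.filter fun j => 0 < d j

theorem mem_release {M : Finset (Fin n)} {d : Fin n → ℤ} {j : Fin n} :
    j ∈ release M d ↔ j ∈ M ∨ 0 < d j := by simp [release]

/-- The approximation property (with `B = +∞`) by recursion on the list `Es` of remaining tuples
of intervals. The components in `M` may decrease, those in `I \ M` have to be nonnegative. -/
def Sat (I : Finset (Fin n)) : Finset (Fin n) → List (Fin n → IntervalExpr) → (Fin n → ℤ) →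
    List (Fin n → ℤ) → Prop
  | M, [], u, path => path = [] ∧ ∀ j ∈ I, j ∉ M → 0 ≤ u j
  | M, E :: Es, u, path => ∃ p q r, path = p ++ (q ++ r) ∧ (∀ j, q.sum j ∈ (E j).toSet) ∧
      (∀ j, j ∉ M → 0 ≤ q.sum j) ∧
      (∀ a, a <+: p ++ q → a ≠ p ++ q → ∀ j ∈ I, j ∉ M → 0 ≤ u j + a.sum j) ∧
      Sat I (release M q.sum) Es (u + p.sum + q.sum) r

/-- The intervals see only differences, and the configurations themselves are tested only on `I \
M`, where `M` can only grow. This allows a tail to be attached to a shortened stage whose endpoint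
differs on the remaining components. -/
theorem Sat.congr {I : Finset (Fin n)} {Es : List (Fin n → IntervalExpr)} {M : Finset (Fin n)}
    {u u' : Fin n → ℤ} {path : List (Fin n → ℤ)} (h : Sat I M Es u path)
    (hu : ∀ j ∈ I, j ∉ M → u j = u' j) : Sat I M Es u' path := by
  induction Es generalizing M u u' path with
  | nil => exact ⟨h.1, fun j hj hM => hu j hj hM ▸ h.2 j hj hM⟩
  | cons E Es ih =>
    obtain ⟨p, q, r, h1, h2, h3, h4, h5⟩ := h
    refine ⟨p, q, r, h1, h2, h3, fun a ha hne j hj hM => hu j hj hM ▸ h4 a ha hne j hj hM,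
      ih h5 fun j hj hM => ?_⟩
    rw [mem_release, not_or] at hM
    simp [hu j hj hM.1]

theorem Sat.mono {I I' : Finset (Fin n)} {Es : List (Fin n → IntervalExpr)} {M : Finset (Fin n)}
    {u : Fin n → ℤ} {path : List (Fin n → ℤ)} (h : Sat I M Es u path) (hI : I' ⊆ I) :
    Sat I' M Es u path := by
  induction Es generalizing M u path with
  | nil => exact ⟨h.1, fun j hj => h.2 j (hI hj)⟩
  | cons E Es ih =>
    obtain ⟨p, q, r, h1, h2, h3, h4, h5⟩ := h
    exact ⟨p, q, r, h1, h2, h3, fun a ha hne j hj => h4 a ha hne j (hI hj), ih h5⟩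

theorem neg_maxDec_le_list_sum {T : Finset (Fin n → ℤ)} {p : List (Fin n → ℤ)}
    (hp : ∀ t ∈ p, t ∈ T) (j : Fin n) : -(maxDec T * p.length : ℤ) ≤ p.sum j := by
  induction p with
  | nil => simp
  | cons t p ih =>
    have h := ih fun s hs => hp s (List.mem_cons_of_mem _ hs)
    have h1 : (-(t j)).toNat ≤ Finset.univ.sup fun i : Fin n => (-(t i)).toNat :=
      Finset.le_sup (f := fun i : Fin n => (-(t i)).toNat) (Finset.mem_univ j)
    have h2 : (Finset.univ.sup fun i : Fin n => (-(t i)).toNat) ≤ maxDec T :=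
      Finset.le_sup (f := fun b : Fin n → ℤ => Finset.univ.sup fun i : Fin n => (-(b i)).toNat)
        (hp t List.mem_cons_self)
    have h3 : -(maxDec T : ℤ) ≤ t j := by
      have := h1.trans h2
      omega
    rw [List.sum_cons, Pi.add_apply, List.length_cons]
    push_cast
    linarith

/-- A component that is initially large compared to the length of the path never matters. -/
theorem Sat.of_erase {T : Finset (Fin n → ℤ)} {I : Finset (Fin n)} {j₀ : Fin n}
    {Es : List (Fin n → IntervalExpr)} {M : Finset (Fin n)} {u : Fin n → ℤ}
    {path : List (Fin n → ℤ)} (h : Sat (I.erase j₀) M Es u path) (hT : ∀ t ∈ path, t ∈ T)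
    (hu : (maxDec T * path.length : ℤ) ≤ u j₀) : Sat I M Es u path := by
  induction Es generalizing M u path with
  | nil =>
    refine ⟨h.1, fun j hj hM => ?_⟩
    by_cases hj₀ : j = j₀
    · subst hj₀
      simpa [h.1] using hu
    · exact h.2 j (Finset.mem_erase.mpr ⟨hj₀, hj⟩) hM
  | cons E Es ih =>
    obtain ⟨p, q, r, rfl, h2, h3, h4, h5⟩ := h
    refine ⟨p, q, r, rfl, h2, h3, fun a ha hne j hj hM => ?_,
      ih h5 (fun t ht => hT t (by simp [ht])) ?_⟩
    · by_cases hj₀ : j = j₀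
      · subst hj₀
        have h6 := neg_maxDec_le_list_sum (T := T)
          (fun t ht => hT t (by have := ha.subset ht; simp at this ⊢; tauto)) j (p := a)
        have h7 : (maxDec T * a.length : ℤ) ≤ maxDec T * (p ++ (q ++ r)).length := by
          have := ha.length_le
          simp only [List.length_append] at this ⊢
          exact_mod_cast Nat.mul_le_mul_left _ (by omega)
        linarith
      · exact h4 a ha hne j (Finset.mem_erase.mpr ⟨hj₀, hj⟩) hM
    · have h6 := neg_maxDec_le_list_sum (T := T) (p := p) (fun t ht => hT t (by simp [ht])) j₀
      have h7 := neg_maxDec_le_list_sum (T := T) (p := q) (fun t ht => hT t (by simp [ht])) j₀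
      simp only [List.length_append, Pi.add_apply] at hu ⊢
      push_cast at hu
      linarith

/-- The walk `a` is absorbed into the untested part `p` of the first stage. -/
theorem Sat.prepend {I : Finset (Fin n)} {E : Fin n → IntervalExpr}
    {Es : List (Fin n → IntervalExpr)} {M : Finset (Fin n)} {u : Fin n → ℤ}
    {a path : List (Fin n → ℤ)} (h : Sat I M (E :: Es) (u + a.sum) path)
    (ha : ∀ b, b <+: a → b ≠ a → ∀ j ∈ I, j ∉ M → 0 ≤ u j + b.sum j) :
    Sat I M (E :: Es) u (a ++ path) := by
  obtain ⟨p, q, r, rfl, h2, h3, h4, h5⟩ := h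
  refine ⟨a ++ p, q, r, by simp, h2, h3, fun b hb hne j hj hM => ?_, ?_⟩
  · rw [List.append_assoc] at hb hne
    rcases strict_prefix_append_cases hb hne with ⟨hb, hne⟩ | ⟨c, hc, hne, rfl⟩
    · exact ha b hb hne j hj hM
    · have := h4 c hc (by simpa using hne) j hj hM
      simpa [add_assoc] using this
  · simpa [add_assoc] using h5

/-- From each configuration before the end of the first stage the property can be satisfied anew,
by repeating the pumped part of this stage if necessary. -/
theorem Sat.exists_restart {I : Finset (Fin n)} {E : Fin n → IntervalExpr}
    {Es : List (Fin n → IntervalExpr)} {M : Finset (Fin n)} {u : Fin n → ℤ}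
    {p q r a : List (Fin n → ℤ)} (h2 : ∀ j, q.sum j ∈ (E j).toSet)
    (h3 : ∀ j, j ∉ M → 0 ≤ q.sum j)
    (h4 : ∀ a, a <+: p ++ q → a ≠ p ++ q → ∀ j ∈ I, j ∉ M → 0 ≤ u j + a.sum j)
    (h5 : Sat I (release M q.sum) Es (u + p.sum + q.sum) r)
    (ha : a <+: p ++ q) (hne : a ≠ p ++ q) :
    ∃ e, e ⊆ p ++ q ∧ Sat I M (E :: Es) (u + a.sum) (e ++ (q ++ r)) := by
  rcases strict_prefix_append_cases ha hne with ⟨⟨e, rfl⟩, hap⟩ | ⟨b, ⟨e, rfl⟩, hbe, rfl⟩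
  · refine ⟨e, fun t ht => by simp [ht], e, q, r, rfl, h2, h3, fun b hb hbne j hj hM => ?_, ?_⟩
    · have := h4 (a ++ b) (by rw [List.append_assoc]; exact (List.prefix_append_right_inj a).mpr hb)
        (by rw [List.append_assoc]; simpa using hbne) j hj hM
      simpa [add_assoc] using this
    · simpa [add_assoc] using h5
  -- The cut falls inside `q = b ++ e`. The rest `e` becomes the new `p`, and `q` is run once more
  -- in full. Components outside `M` have nonnegative effect under `q`, so the second run stays at
  -- least as high on them.
  · refine ⟨e, fun t ht => by simp [ht], e, b ++ e, r, rfl, h2, h3, fun c hc hcne j hj hM => ?_,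
      -- The new endpoint is off by one further `q.sum`, which vanishes on unreleased components: it
      -- is nonnegative and not positive there.
      h5.congr fun j hj hM => ?_⟩
    · rcases strict_prefix_append_cases hc hcne with ⟨hc, hcne⟩ | ⟨g, hg, hgne, rfl⟩
      · have := h4 (p ++ (b ++ c)) ((List.prefix_append_right_inj p).mpr
          ((List.prefix_append_right_inj b).mpr hc)) (by simpa using hcne) j hj hM
        simpa [add_assoc] using this
      · have h6 := h4 (p ++ g) ((List.prefix_append_right_inj p).mpr hg)
          (by simpa using hgne) j hj hM
        have h7 := h3 j hM
        simp only [List.sum_append, Pi.add_apply] at h6 h7 ⊢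
        linarith
    · rw [mem_release, not_or] at hM
      have h7 := h3 j hM.1
      have h8 := hM.2
      simp only [List.sum_append, Pi.add_apply] at h7 h8 ⊢
      linarith

/-- A list of tuples of intervals of scale at most `σ`. -/
def ScaleLe (σ : ℕ) (Es : List (Fin n → IntervalExpr)) : Prop :=
  ∀ E ∈ Es, ∀ j, (E j).maxAbs ≤ σ

/-- If the property can be satisfied by short paths whenever one component is disregarded, then
it can be satisfied by a short path. -/
theorem Sat.exists_short_of_erase {T : Finset (Fin n → ℤ)} (hT : 1 ≤ absMax T) {σ : ℕ}
    (hσ : 1 ≤ σ) {I : Finset (Fin n)} {B R : ℕ} (hB : 1 ≤ B) {Es : List (Fin n → IntervalExpr)}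
    (hEs : ScaleLe σ Es)
    (hesc : ∀ j ∈ I, ∀ M Es' u path, Es' <:+ Es → (∀ t ∈ path, t ∈ T) →
      Sat (I.erase j) M Es' u path → ∃ path', (∀ t ∈ path', t ∈ T) ∧
        Sat (I.erase j) M Es' u path' ∧ maxDec T * path'.length ≤ B ∧ path'.length ≤ R)
    {M : Finset (Fin n)} {u : Fin n → ℤ} {path : List (Fin n → ℤ)} (hpath : ∀ t ∈ path, t ∈ T)
    (h : Sat I M Es u path) :
    ∃ path', (∀ t ∈ path', t ∈ T) ∧ Sat I M Es u path' ∧ path'.length ≤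
      Es.length * (B ^ n + segmentBound n (absMax T) σ (B ^ n)) + B ^ n + R := by
  induction Es generalizing M u path with
  | nil => exact ⟨[], by simp, ⟨rfl, h.2⟩, by simp⟩
  | cons E Es ih =>
    obtain ⟨p, q, r, rfl, h2, h3, h4, h5⟩ := h
    have hpqT : ∀ t ∈ p ++ q, t ∈ T := fun t ht => hpath t (by simp at ht ⊢; tauto)
    have hrT : ∀ t ∈ r, t ∈ T := fun t ht => hpath t (by simp [ht])
    by_cases hlarge : ∃ a, a <+: p ++ q ∧ a ≠ p ++ q ∧ ∃ j ∈ I, j ∉ M ∧ (B : ℤ) ≤ u j + a.sum j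
    · obtain ⟨a, ⟨ha, hne, j, hj, hjM, hBj⟩, hmin⟩ :=
        (measure (List.length (α := Fin n → ℤ))).wf.has_min {a | a <+: p ++ q ∧ a ≠ p ++ q ∧
          ∃ j ∈ I, j ∉ M ∧ (B : ℤ) ≤ u j + a.sum j} hlarge
      have hstrict : ∀ b, b <+: a → b ≠ a → b <+: p ++ q ∧ b ≠ p ++ q := by
        intro b hb hba
        refine ⟨hb.trans ha, ?_⟩
        rintro rfl
        exact hne (ha.eq_of_length_le hb.length_le)
      obtain ⟨e, he, hsat⟩ := Sat.exists_restart h2 h3 h4 h5 ha hne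
      obtain ⟨path', hp'T, hp'sat, hp'B, hp'R⟩ := hesc j hj M (E :: Es) _ _ (List.suffix_refl _)
        (by
          intro t ht
          simp only [List.mem_append] at ht
          rcases ht with ht | ht | ht
          · exact hpqT t (he ht)
          · exact hpqT t (by simp [ht])
          · exact hrT t ht) (hsat.mono (Finset.erase_subset j I))
      -- Component `j` starts at `B` or higher, while the continuation can lower it by at most
      -- `maxDec T * path'.length ≤ B`.
      have hfull := hp'sat.of_erase hp'T (by
        refine le_trans ?_ hBj
        exact_mod_cast hp'B)
      obtain ⟨a', ha'a, ha', hsum, hlen⟩ := exists_short_bounded_walk (I \ M) hB u a (by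
        intro b hb hba i hi
        obtain ⟨hbp, hbne⟩ := hstrict b hb hba
        rw [Finset.mem_sdiff] at hi
        refine ⟨h4 b hbp hbne i hi.1 hi.2, ?_⟩
        by_contra! hge
        refine hmin b ⟨hbp, hbne, i, hi.1, hi.2, hge⟩ ?_
        exact lt_of_le_of_ne hb.length_le fun h => hba (hb.eq_of_length h))
      refine ⟨a' ++ path', ?_, Sat.prepend (hfull.congr fun i hi hiM => ?_) ?_, ?_⟩
      · intro t ht
        rcases List.mem_append.mp ht with ht | ht
        · exact hpqT t (ha.subset (ha'a ht))
        · exact hp'T t ht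
      · simp [hsum i (Finset.mem_sdiff.mpr ⟨hi, hiM⟩)]
      · exact fun b hb hba i hi hiM => ha' b hb hba i (Finset.mem_sdiff.mpr ⟨hi, hiM⟩)
      · rw [List.length_append]
        exact (Nat.add_le_add hlen hp'R).trans (by omega)
    · have hbdd : ∀ a, a <+: p ++ q → a ≠ p ++ q → ∀ j ∈ I \ M,
          0 ≤ u j + a.sum j ∧ u j + a.sum j < B := by
        intro a ha hne j hj
        rw [Finset.mem_sdiff] at hj
        refine ⟨h4 a ha hne j hj.1 hj.2, ?_⟩
        by_contra! hge
        exact hlarge ⟨a, ha, hne, j, hj.1, hj.2, hge⟩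
      obtain ⟨p', hp'p, hp', hp'sum, hp'len⟩ := exists_short_bounded_walk (I \ M) hB u p (by
        intro a ha hne
        refine hbdd a (ha.trans (List.prefix_append _ _)) ?_
        rintro rfl
        exact hne (ha.eq_of_length_le (by simp)))
      obtain ⟨q', hq'T, hq', hq'sum, hq'tr, hq'len⟩ := exists_short_segment hT (I \ M) hB σ
        (u + p.sum) q (fun t ht => hpqT t (by simp [ht])) (by
          intro a ha hne j hj
          have := hbdd (p ++ a) ((List.prefix_append_right_inj p).mpr ha) (by simpa using hne) j hj
          simpa [add_assoc] using this)
      -- Truncation at `σ ≥ 1` preserves signs, so the same components are released.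
      have hrel : release M q'.sum = release M q.sum := by
        ext j
        rw [mem_release, mem_release, (hq'tr j).pos_iff hσ]
      obtain ⟨r', hr'T, hr'sat, hr'len⟩ := ih (fun E' hE' => hEs E' (List.mem_cons_of_mem _ hE'))
        (fun j hj M' Es' u' path' hs => hesc j hj M' Es' u' path' (hs.trans (List.suffix_cons _ _)))
        hrT h5
      refine ⟨p' ++ (q' ++ r'), ?_, ⟨p', q', r', rfl, fun j => ?_, fun j hj => ?_,
        fun a ha hne j hj hM => ?_, ?_⟩, ?_⟩
      · intro t ht
        simp only [List.mem_append] at ht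
        rcases ht with ht | ht | ht
        · exact hpqT t (by simp [hp'p ht])
        · exact hq'T t ht
        · exact hr'T t ht
      · exact (hq'tr j).mem_toSet (hEs E List.mem_cons_self j) (h2 j)
      · exact ((hq'tr j).nonneg_iff hσ).mpr (h3 j hj)
      · have hjIM : j ∈ I \ M := Finset.mem_sdiff.mpr ⟨hj, hM⟩
        rcases strict_prefix_append_cases ha hne with ⟨ha, hne⟩ | ⟨b, hb, hbne, rfl⟩
        · exact hp' a ha hne j hjIM
        · have := hq' b hb hbne j hjIM
          rw [Pi.add_apply, ← hp'sum j hjIM] at this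
          simpa [add_assoc] using this
      · rw [hrel]
        refine hr'sat.congr fun j hj hM => ?_
        rw [mem_release, not_or] at hM
        have hjIM : j ∈ I \ M := Finset.mem_sdiff.mpr ⟨hj, hM.1⟩
        simp [hp'sum j hjIM, hq'sum j hjIM]
      · simp only [List.length_append, List.length_cons, Nat.succ_mul]
        omega

/-- Short paths for the approximation property, with a bound `G` on the number of configurations
that depends on the number of components required to be nonnegative. -/
theorem Sat.exists_short {T : Finset (Fin n → ℤ)} (hT : 1 ≤ absMax T) (hdec : 1 ≤ maxDec T)
    {σ : ℕ} (hσ : 1 ≤ σ) {K : ℕ} {G : ℕ → ℕ}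
    (hG0 : K * (1 ^ n + segmentBound n (absMax T) σ (1 ^ n)) + 1 ^ n + 1 ≤ G 0)
    (hG : ∀ i, K * ((maxDec T * G i) ^ n + segmentBound n (absMax T) σ ((maxDec T * G i) ^ n)) +
      (maxDec T * G i) ^ n + G i ≤ G (i + 1))
    {Es : List (Fin n → IntervalExpr)} (hEs : ScaleLe σ Es) (hK : Es.length ≤ K)
    {I M : Finset (Fin n)} {u : Fin n → ℤ} {path : List (Fin n → ℤ)} (hpath : ∀ t ∈ path, t ∈ T)
    (h : Sat I M Es u path) :
    ∃ path', (∀ t ∈ path', t ∈ T) ∧ Sat I M Es u path' ∧ path'.length + 1 ≤ G I.card := by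
  induction hi : I.card generalizing I M Es u path with
  | zero =>
    rw [Finset.card_eq_zero] at hi
    subst hi
    -- With no constrained component nothing can become large: the bound 1 suffices and no
    -- continuation has to be paid for.
    obtain ⟨path', h1, h2, h3⟩ := Sat.exists_short_of_erase hT hσ (B := 1) (R := 0) le_rfl hEs
      (by simp) hpath h
    have := Nat.mul_le_mul_right (1 ^ n + segmentBound n (absMax T) σ (1 ^ n)) hK
    exact ⟨path', h1, h2, by omega⟩
  | succ i ih =>
    have hGmono : ∀ i, 1 ≤ G i := by
      intro i
      induction i with
      | zero => exact (Nat.le_add_left 1 _).trans hG0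
      | succ i ih => have := hG i; omega
    have hGi := hGmono i
    -- `G` counts configurations and `R` counts transitions, hence `G i - 1`.
    obtain ⟨path', h1, h2, h3⟩ := Sat.exists_short_of_erase hT hσ (B := maxDec T * G i)
      (R := G i - 1) (Nat.mul_pos hdec hGi) hEs (by
        intro j hj M' Es' u' path' hsuf hp' hs
        obtain ⟨path'', h1, h2, h3⟩ := ih (fun E hE => hEs E (hsuf.subset hE))
          (hsuf.length_le.trans hK) hp' hs (by rw [Finset.card_erase_of_mem hj, hi]; rfl)
        exact ⟨path'', h1, h2, Nat.mul_le_mul_left _ (by omega), by omega⟩) hpath h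
    have := Nat.mul_le_mul_right ((maxDec T * G i) ^ n +
      segmentBound n (absMax T) σ ((maxDec T * G i) ^ n)) hK
    have := hG i
    exact ⟨path', h1, h2, by omega⟩

end Sat

/-! ### Translation between decompositions and the recursive property -/

section Decomposition

variable {n : ℕ}

/-- The tuples of intervals of a property, extended trivially to all indices. -/
def GenUnbProp.tuple (P : GenUnbProp n) (l : ℕ) : Fin n → IntervalExpr :=
  if h : l ∈ Finset.Icc 1 P.K then P.interval ⟨l, h⟩ else fun _ => .univ

theorem GenUnbProp.tuple_of_mem (P : GenUnbProp n) {l : ℕ} (h : l ∈ Finset.Icc 1 P.K) :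
    P.tuple l = P.interval ⟨l, h⟩ := dif_pos h

theorem GenUnbProp.maxAbs_tuple_le (P : GenUnbProp n) (l : ℕ) (j : Fin n) :
    (P.tuple l j).maxAbs ≤ P.scale := by
  by_cases h : l ∈ Finset.Icc 1 P.K
  · rw [P.tuple_of_mem h, scale]
    refine le_max_of_le_right (le_trans ?_ (Finset.le_sup (Finset.mem_univ
      (⟨l, h⟩ : Finset.Icc 1 P.K))))
    exact Finset.le_sup (f := fun j => (P.interval ⟨l, h⟩ j).maxAbs) (Finset.mem_univ j)
  · simp [tuple, h, IntervalExpr.maxAbs]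

/-- The tuples of intervals of a property with the indices `l + 1, …, l + k`. -/
def GenUnbProp.tuples (P : GenUnbProp n) (l k : ℕ) : List (Fin n → IntervalExpr) :=
  (List.range' (l + 1) k).map P.tuple

theorem GenUnbProp.tuples_succ (P : GenUnbProp n) (l k : ℕ) :
    P.tuples l (k + 1) = P.tuple (l + 1) :: P.tuples (l + 1) k := by
  simp [tuples, List.range'_succ]

variable {T : Finset (Fin n → ℤ)}

theorem PseudoRun.config_apply (ρ : PseudoRun T) (m : ℕ) (j : Fin n) :
    ρ.config m j = ρ.initial j + (ρ.path.take m).sum j := rfl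

theorem PseudoRun.config_add (ρ : PseudoRun T) (i m : ℕ) :
    ρ.config (i + m) = ρ.config i + ((ρ.path.drop i).take m).sum := by
  rw [config, config, List.take_add, List.sum_append, add_assoc]

theorem PseudoRun.SatisfiesApprox.sat {P : GenUnbProp n} {l : ℕ} (hl : 1 ≤ l) (hlK : l ≤ P.K)
    {INCR I : Finset (Fin n)} {ρ : PseudoRun T} (h : ρ.SatisfiesApprox P l INCR I ⊤) :
    Sat I INCR (P.tuples (l - 1) (P.K + 1 - l)) ρ.initial ρ.path := by
  classical
  obtain ⟨f, ⟨hf0, hfK, hmono⟩, h1, h2, h3⟩ := h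
  -- `R l'` is the set of components released after stage `l'`; it plays the role of `M` for the
  -- tail of the run starting at position `f (2 * l')`.
  let R : ℕ → Finset (Fin n) := fun l' => INCR ∪ Finset.univ.filter fun j =>
    ∃ l'', l ≤ l'' ∧ l'' ≤ l' ∧ 0 < ρ.diff f l'' j
  have hR : ∀ l' j, j ∈ R l' ↔ j ∈ INCR ∨ ∃ l'', l ≤ l'' ∧ l'' ≤ l' ∧ 0 < ρ.diff f l'' j := by
    intro l' j; simp [R]
  suffices hmain : ∀ k l', l - 1 ≤ l' → l' + k = P.K →
      Sat I (R l') (P.tuples l' k) (ρ.config (f (2 * l'))) (ρ.path.drop (f (2 * l'))) by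
    have := hmain (P.K + 1 - l) (l - 1) le_rfl (by omega)
    have h0 : 2 * (l - 1) = 2 * l - 2 := by omega
    have hR0 : R (l - 1) = INCR := by
      ext j
      rw [hR]
      refine ⟨fun h => h.resolve_right ?_, Or.inl⟩
      rintro ⟨l'', h1, h2, -⟩
      omega
    rw [h0, hf0, hR0] at this
    simpa [config] using this
  intro k
  induction k with
  | zero =>
    intro l' hl' hK
    obtain rfl : l' = P.K := by omega
    refine ⟨by rw [hfK, List.drop_length], fun j hj hjR => ?_⟩
    rw [hR, not_or] at hjR
    exact (h3 P.K hl' le_rfl _ hfK.le le_rfl (fun h => absurd h (lt_irrefl _)) j hj hjR.1 hjR.2).1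
  | succ k ih =>
    intro l' hl' hK
    have hle1 : f (2 * l') ≤ f (2 * l' + 1) :=
      hmono ⟨by omega, by omega⟩ ⟨by omega, by omega⟩ (by omega)
    have hle2 : f (2 * l' + 1) ≤ f (2 * l' + 2) :=
      hmono ⟨by omega, by omega⟩ ⟨by omega, by omega⟩ (by omega)
    have hle3 : f (2 * l' + 2) ≤ ρ.path.length := by
      rw [← hfK]; exact hmono ⟨by omega, by omega⟩ ⟨by omega, by omega⟩ (by omega)
    obtain ⟨a, ha⟩ := Nat.exists_eq_add_of_le hle1
    obtain ⟨b, hb⟩ := Nat.exists_eq_add_of_le hle2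
    set i := f (2 * l') with hi
    have hq : ((ρ.path.drop (i + a)).take b).sum = ρ.diff f (l' + 1) := by
      ext j
      have hidx : 2 * (l' + 1) - 1 = 2 * l' + 1 := by omega
      rw [diff, hidx, mul_add, mul_one, hb, ha, config_add ρ (i + a) b, Pi.add_apply]
      ring
    have hK' : l' + 1 ∈ Finset.Icc 1 P.K := Finset.mem_Icc.mpr ⟨by omega, by omega⟩
    have hrel : release (R l') (ρ.diff f (l' + 1)) = R (l' + 1) := by
      ext j
      rw [mem_release, hR, hR, or_assoc]
      refine or_congr_right ⟨?_, ?_⟩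
      · rintro (⟨l'', h1, h2, h3⟩ | h)
        · exact ⟨l'', h1, by omega, h3⟩
        · exact ⟨l' + 1, by omega, le_rfl, h⟩
      · rintro ⟨l'', h1, h2, h3⟩
        rcases Nat.lt_or_ge l'' (l' + 1) with h | h
        · exact Or.inl ⟨l'', h1, by omega, h3⟩
        · obtain rfl : l'' = l' + 1 := by omega
          exact Or.inr h3
    have hpq : (ρ.path.drop i).take a ++ (ρ.path.drop (i + a)).take b =
        (ρ.path.drop i).take (a + b) := by
      rw [List.take_add, List.drop_drop]
    rw [P.tuples_succ]
    refine ⟨(ρ.path.drop i).take a, (ρ.path.drop (i + a)).take b, ρ.path.drop (i + a + b),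
      ?_, fun j => ?_, fun j hj => ?_, fun c hc hne j hj hjR => ?_, ?_⟩
    · rw [← List.append_assoc, hpq, add_assoc, ← List.drop_drop, List.take_append_drop]
    · rw [hq, P.tuple_of_mem hK']
      exact h1 (l' + 1) hK' (by omega) j
    · rw [hq]
      by_contra! hneg
      rw [hR, not_or] at hj
      rcases h2 (l' + 1) (by omega) (by omega) j hneg with ⟨l'', h1, h2, h3⟩ | h
      · exact hj.2 ⟨l'', h1, by omega, h3⟩
      · exact hj.1 h
    -- Strict prefixes of `p ++ q` are exactly the positions from `f (2 * l')` to strictly before `f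
    -- (2 * l' + 2)`.
    · rw [hpq] at hc hne
      have hlen : c.length < a + b := by
        by_contra! hge
        refine hne (hc.eq_of_length_le (le_trans ?_ hge))
        exact List.length_take_le _ _
      have hc' : c = (ρ.path.drop i).take c.length := by
        have := List.prefix_iff_eq_take.mp hc
        rw [List.take_take, min_eq_left hlen.le] at this
        exact this
      rw [hR, not_or] at hjR
      have := (h3 l' hl' (by omega) (i + c.length) (by omega) (by omega) (fun _ => by omega) j hj
        hjR.1 hjR.2).1
      rw [config_add, ← hc'] at this
      exact this
    · rw [hq, hrel, ← config_add, ← hq, ← config_add, ← ha, ← hb]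
      exact ih (l' + 1) (by omega) (by omega)

/-- The run after the first stage is a pseudo-run `ρ'` of its own; its decomposition, shifted by the
length of `p ++ q`, is completed by the two cuts of the first stage. What `ρ'` may decrease because
of `release` is accounted for by an increase in stage `l + 1`. -/
theorem PseudoRun.satisfiesApprox_of_sat {P : GenUnbProp n} {l k : ℕ} (hk : l + k = P.K)
    {M I : Finset (Fin n)} {ρ : PseudoRun T} (h : Sat I M (P.tuples l k) ρ.initial ρ.path) :
    ρ.SatisfiesApprox P (l + 1) M I ⊤ := by
  induction k generalizing l M ρ with
  | zero =>
    obtain rfl : l = P.K := by omega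
    obtain ⟨h1, h2⟩ := h
    refine ⟨fun _ => 0, ⟨rfl, by simp [h1], fun _ _ _ _ _ => le_rfl⟩, ?_, ?_, ?_⟩
    · intro l' hl' hle
      rw [Finset.mem_Icc] at hl'
      omega
    · intro l' h h'
      omega
    · intro l' _ _ m hm _ _ j hj hjM _
      refine ⟨?_, ENat.natCast_lt_top _⟩
      obtain rfl : m = 0 := by simpa [h1] using hm
      simpa [config] using h2 j hj hjM
  | succ k ih =>
    rw [P.tuples_succ] at h
    obtain ⟨p, q, r, hpath, h2, h3, h4, h5⟩ := h
    let ρ' : PseudoRun T := ⟨ρ.initial + p.sum + q.sum, r, fun t ht => ρ.path_mem t (by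
      rw [hpath]; simp [ht])⟩
    obtain ⟨f', ⟨hf0, hfK, hmono⟩, g1, g2, g3⟩ := ih (ρ := ρ') (by omega) h5
    have hlast : 2 * (l + 1 + 1) - 2 = 2 * l + 2 := by omega
    rw [hlast] at hf0 hmono
    let f : ℕ → ℕ := fun x => if x ≤ 2 * l then 0 else if x = 2 * l + 1 then p.length else
      p.length + q.length + f' x
    have hfa : f (2 * l) = 0 := by simp [f]
    have hfb : f (2 * l + 1) = p.length := by simp [f]
    have hfc : ∀ x, 2 * l + 2 ≤ x → f x = p.length + q.length + f' x := by
      intro x hx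
      simp only [f]
      rw [if_neg (by omega), if_neg (by omega)]
    have hcfg : ∀ m, ρ.config (p.length + q.length + m) = ρ'.config m := by
      intro m
      simp only [config, hpath, ρ']
      rw [← List.append_assoc, ← List.length_append, List.take_length_add_append]
      simp [add_assoc]
    have hd : ρ.diff f (l + 1) = q.sum := by
      ext j
      have hidx : 2 * (l + 1) - 1 = 2 * l + 1 := by omega
      rw [diff, hidx, mul_add, mul_one, hfb, hfc _ le_rfl, hf0, hcfg]
      simp [config, hpath, ρ']
    have hd' : ∀ l', l + 2 ≤ l' → ρ.diff f l' = ρ'.diff f' l' := by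
      intro l' hl'
      ext j
      rw [diff, diff, hfc _ (by omega), hfc _ (by omega), hcfg, hcfg]
    have hsplit : ∀ {l'}, l + 1 ≤ l' → l' = l + 1 ∨ l + 2 ≤ l' := by omega
    refine ⟨f, ⟨?_, ?_, ?_⟩, ?_, ?_, ?_⟩
    · rw [show 2 * (l + 1) - 2 = 2 * l by omega, hfa]
    · rw [hfc _ (by omega), hfK, hpath]
      simp [ρ', add_assoc]
    · intro x hx y hy hxy
      rw [Set.mem_Icc] at hx hy
      rcases Nat.lt_or_ge x (2 * l + 2) with hx' | hx'
      · rcases Nat.lt_or_ge y (2 * l + 2) with hy' | hy'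
        · simp only [f]
          split_ifs <;> omega
        · rw [hfc y hy']
          simp only [f]
          split_ifs <;> omega
      · rw [hfc x hx', hfc y (by omega)]
        exact Nat.add_le_add_left (hmono ⟨hx', hx.2⟩ ⟨by omega, hy.2⟩ hxy) _
    · intro l' hl' hle j
      rcases hsplit hle with rfl | hle
      · rw [hd, ← P.tuple_of_mem hl']; exact h2 j
      · rw [hd' l' hle]; exact g1 l' hl' hle j
    · intro l' hle hleK j hneg
      rcases hsplit hle with rfl | hle
      · rw [hd] at hneg
        right
        by_contra hj
        exact absurd (h3 j hj) (not_le.mpr hneg)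
      · rw [hd' l' hle] at hneg
        rcases g2 l' hle hleK j hneg with ⟨l'', h, h', hpos⟩ | hj
        · exact Or.inl ⟨l'', by omega, h', by rwa [hd' l'' h]⟩
        · rcases mem_release.mp hj with hj | hj
          · exact Or.inr hj
          · exact Or.inl ⟨l + 1, le_rfl, by omega, by rwa [hd]⟩
    · intro l' hle hleK m hm hfm hmf j hj hjM hno
      refine ⟨?_, ENat.natCast_lt_top _⟩
      rcases Nat.eq_or_lt_of_le (show l ≤ l' by simpa using hle) with rfl | hlt
      · have hm' := hmf (by omega)
        rw [hfc _ le_rfl, hf0, add_zero] at hm'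
        rw [config_apply, hpath, ← List.append_assoc,
          List.take_append_of_le_length (by simpa using hm'.le)]
        refine h4 _ (List.take_prefix _ _) (fun h => ?_) j hj hjM
        have := congrArg List.length h
        simp only [List.length_take, List.length_append] at this
        omega
      · rw [hfc _ (by omega)] at hfm
        obtain ⟨m, rfl⟩ := Nat.exists_eq_add_of_le (show p.length + q.length ≤ m by omega)
        rw [hcfg]
        refine (g3 l' (by simpa using hlt) hleK m ?_ (by omega) (fun h => ?_) j hj ?_ ?_).1
        · rw [hpath] at hm
          simp only [List.length_append] at hm
          change m ≤ r.length
          omega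
        · have := hmf h
          rw [hfc _ (by omega)] at this
          omega
        · rw [mem_release, not_or]
          refine ⟨hjM, fun hpos => hno ⟨l + 1, le_rfl, hlt, by rwa [hd]⟩⟩
        · rintro ⟨l'', h, h', hpos⟩
          exact hno ⟨l'', by omega, h', by rwa [hd' l'' h]⟩

end Decomposition

/-! ### Numerical estimate and conclusion -/

/-- Every parameter is at most `X`, and `X ≥ 4`, so numerical constants cost only a bounded power of
`X`. The dominant term is `M` times the number of selected loops, of order `X ^ (n + (2 * n + 3) *
n)`; the total exponent `2 * n ^ 2 + 4 * n + 3` is at most `n ^ 5` because `n ≥ 2`. -/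
theorem stage_bound_le {n τ σ B K : ℕ} (hn : 2 ≤ n) (hτ : 1 ≤ τ) (hσ : 1 ≤ σ) (hB : 1 ≤ B)
    (hK : 1 ≤ K) : K * (B ^ n + segmentBound n τ σ (B ^ n)) + B ^ n + 1 ≤
      (2 * ((1 + K) * τ * σ) * B) ^ (n ^ 5) := by
  set X := 2 * ((1 + K) * τ * σ) * B with hX
  have hXK : 2 * (1 + K) ≤ X := by
    calc 2 * (1 + K) = 2 * ((1 + K) * 1 * 1) * 1 := by ring
      _ ≤ X := by rw [hX]; gcongr
  have hXτ : τ ≤ X := by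
    calc τ = 1 * ((1 + 0) * τ * 1) * 1 := by ring
      _ ≤ X := by rw [hX]; gcongr <;> omega
  have hXσ : σ ≤ X := by
    calc σ = 1 * ((1 + 0) * 1 * σ) * 1 := by ring
      _ ≤ X := by rw [hX]; gcongr <;> omega
  have hXB : B ≤ X := by
    calc B = 1 * ((1 + 0) * 1 * 1) * B := by ring
      _ ≤ X := by rw [hX]; gcongr <;> omega
  clear_value X
  have hX1 : 1 ≤ X := by omega
  have h16 : 16 ≤ X ^ 2 := by nlinarith
  have hM : B ^ n ≤ X ^ n := Nat.pow_le_pow_left hXB n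
  set M := B ^ n
  have hnX : n ≤ X ^ n := (Nat.lt_pow_self (by omega)).le
  have hmono : ∀ {a b : ℕ}, a ≤ b → X ^ a ≤ X ^ b := fun h => Nat.pow_le_pow_right hX1 h
  have hMM : M * M ≤ X ^ (2 * n) := by
    rw [two_mul, pow_add]; exact Nat.mul_le_mul hM hM
  have hpos : ∀ a, 1 ≤ X ^ a := fun a => Nat.one_le_pow _ _ hX1
  have hinner : 2 * (σ + τ * (M * M + 1) + 2 * (τ * M) * n) + 1 ≤ X ^ (2 * n + 3) := by
    have h1 : σ ≤ X ^ (2 * n + 1) := hXσ.trans (Nat.le_self_pow (by omega) X)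
    have h2 : τ * (M * M + 1) ≤ 2 * X ^ (2 * n + 1) := by
      calc τ * (M * M + 1) ≤ X * (X ^ (2 * n) + X ^ (2 * n)) :=
            Nat.mul_le_mul hXτ (Nat.add_le_add hMM (hpos _))
        _ = 2 * X ^ (2 * n + 1) := by ring
    have h3 : 2 * (τ * M) * n ≤ 2 * X ^ (2 * n + 1) := by
      calc 2 * (τ * M) * n ≤ 2 * (X * X ^ n) * X ^ n := by gcongr
        _ = 2 * X ^ (2 * n + 1) := by ring
    have h4 := hpos (2 * n + 1)
    calc _ ≤ 16 * X ^ (2 * n + 1) := by omega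
      _ ≤ X ^ 2 * X ^ (2 * n + 1) := Nat.mul_le_mul_right _ h16
      _ = X ^ (2 * n + 3) := by ring
  have hseg : segmentBound n τ σ M ≤ 4 * X ^ (2 * n ^ 2 + 4 * n) := by
    have h1 : M * M ≤ X ^ (2 * n ^ 2 + 4 * n) := hMM.trans (hmono (by nlinarith))
    have h2 : M * ((2 * (σ + τ * (M * M + 1) + 2 * (τ * M) * n) + 1) ^ n + n) ≤
        2 * X ^ (2 * n ^ 2 + 4 * n) := by
      calc _ ≤ X ^ n * ((X ^ (2 * n + 3)) ^ n + X ^ ((2 * n + 3) * n)) := by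
            refine Nat.mul_le_mul hM (Nat.add_le_add (Nat.pow_le_pow_left hinner n)
              (hnX.trans (hmono (by nlinarith))))
        _ = 2 * X ^ (2 * n ^ 2 + 4 * n) := by
            rw [← pow_mul, ← two_mul, mul_left_comm, ← pow_add]
            ring_nf
    have h3 := hpos (2 * n ^ 2 + 4 * n)
    rw [segmentBound]
    omega
  have hMW : M ≤ X ^ (2 * n ^ 2 + 4 * n) := hM.trans (hmono (by nlinarith))
  have hexp : 2 * n ^ 2 + 4 * n + 3 ≤ n ^ 5 := by
    have h1 : 2 * n ≤ n ^ 2 := by rw [sq]; exact Nat.mul_le_mul_right n hn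
    have h2 : 8 ≤ n ^ 3 := Nat.pow_le_pow_left hn 3
    calc 2 * n ^ 2 + 4 * n + 3 ≤ 8 * n ^ 2 := by omega
      _ ≤ n ^ 3 * n ^ 2 := Nat.mul_le_mul_right _ h2
      _ = n ^ 5 := by ring
  set W := X ^ (2 * n ^ 2 + 4 * n)
  have hW1 : 1 ≤ W := hpos _
  have hWX : W ≤ X * W := Nat.le_mul_of_pos_left _ hX1
  calc K * (M + segmentBound n τ σ M) + M + 1 ≤ X * (5 * W) + X * W + X * W := by
        refine Nat.add_le_add (Nat.add_le_add (Nat.mul_le_mul (by omega) (by omega))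
          (hMW.trans hWX)) (hW1.trans hWX)
    _ = 7 * (X * W) := by ring
    _ ≤ X ^ 2 * (X * W) := Nat.mul_le_mul_right _ (by omega)
    _ = X ^ (2 * n ^ 2 + 4 * n + 3) := by ring
    _ ≤ X ^ (n ^ 5) := hmono hexp

theorem maxDec_le_absMax {n : ℕ} (T : Finset (Fin n → ℤ)) : maxDec T ≤ absMax T :=
  Finset.sup_mono_fun fun _ _ => Finset.sup_mono_fun fun _ _ => by omega

end VAS

theorem mainTheorem5 :
    ∃ C₁ : ℕ, ∀ (n : ℕ) (_ : 2 ≤ n) (T : Finset (Fin n → ℤ)) (_ : 1 ≤ VAS.maxDec T)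
      (P : VAS.GenUnbProp n) (I INCR : Finset (Fin n)) (l : ℕ) (_ : 1 ≤ l) (_ : l ≤ P.K)
      (ρ : VAS.PseudoRun T), ρ.SatisfiesApprox P l INCR I ⊤ →
        ∃ ρ' : VAS.PseudoRun T, ρ'.initial = ρ.initial ∧ ρ'.SatisfiesApprox P l INCR I ⊤ ∧
          ρ'.length ≤ VAS.g C₁ T P I.card := by
  refine ⟨5, fun n hn T hT P I INCR l hl hlK ρ hρ => ?_⟩
  have hτ : 1 ≤ VAS.absMax T := hT.trans (VAS.maxDec_le_absMax T)
  have hσ : 1 ≤ P.scale := le_max_left _ _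
  have hμ : 1 ≤ 2 * VAS.mu T P := by
    have : 0 < (1 + P.K) * VAS.absMax T * P.scale :=
      Nat.mul_pos (Nat.mul_pos (by omega) hτ) hσ
    rw [VAS.mu]
    omega
  have hg : ∀ i, 1 ≤ VAS.g 5 T P i := by
    intro i
    induction i with
    | zero => exact Nat.one_le_pow _ _ hμ
    | succ i ih => exact ih.trans (Nat.le_add_left _ _)
  obtain ⟨path, hpath, hsat, hlen⟩ := VAS.Sat.exists_short (G := VAS.g 5 T P) (K := P.K) hτ hT hσ
    (by
      have := VAS.stage_bound_le hn hτ hσ le_rfl P.one_le_K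
      rwa [mul_one] at this)
    -- The summand `g (i - 1)` in the recursion of `g` pays for the continuation after an escape;
    -- the power pays for all bounded stages.
    (fun i => by
      have := VAS.stage_bound_le hn hτ hσ (Nat.mul_pos hT (hg i)) P.one_le_K
      exact Nat.add_le_add_right ((Nat.le_succ _).trans this) _)
    -- `tuples` starts one past its first argument, so this lists the stages `l, …, K`.
    (Es := P.tuples (l - 1) (P.K + 1 - l))
    (fun E hE j => by
      obtain ⟨i, -, rfl⟩ := List.mem_map.mp hE
      exact P.maxAbs_tuple_le i j)
    (by simp only [VAS.GenUnbProp.tuples, List.length_map, List.length_range']; omega)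
    ρ.path_mem (hρ.sat hl hlK)
  refine ⟨⟨ρ.initial, path, hpath⟩, rfl, ?_, hlen⟩
  have := VAS.PseudoRun.satisfiesApprox_of_sat (ρ := ⟨ρ.initial, path, hpath⟩) (by omega) hsat
  rwa [Nat.sub_add_cancel hl] at this
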